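/- Let $G$ be a finite directed acyclic network (parallel links allowed) with three distinct sources $s_1,s_2,s_3$ and $n$ distinct terminals; every source $s_i$ has an imaginary incoming link (the $X_i$ source link) and every terminal an imaginary outgoing link (a terminal link), and these are counted among the links. For a link $e$, $\mathrm{In}(e)$ is the set of links whose head is the tail of $e$ (source links have no tail, terminal links no head). $G$ is *solvable* if for some finite field $\mathbb F$ there are vectors $d_e\in\mathbb F^3$, one for each link, with $d_e=\alpha_i$ (the $i$-th unit vector) for the $X_i$ source link, $d_e\in\langle d_{e'}: e'\in \mathrm{In}(e)\rangle$ for every non-source link $e$, and $d_e=(1,1,1)$ for every terminal link $e$. A *region* is a set $R$ of links with a link $\mathrm{lead}(R)\in R$ such that each other link of $R$ has an incoming link in $R$. For a partition $D$ of the links into regions, the region graph $\mathrm{RG}(D)$ has vertex set $D$, and $R'$ is a parent of $R$ (and $R$ a child of $R'$) if $R'$ contains an incoming link of $\mathrm{lead}(R)$; write $R'\to R$ if there is a directed path, possibly of length $0$, from $R'$ to $R$. The $X_i$ source region $S_i$ is the region of $D$ whose leader is the $X_i$ source link; a terminal region is one that contains a terminal link. $\mathrm{RG}(D)$ is *feasible*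 if for some finite field $\mathbb F$ there are $d_R\in\mathbb F^3$ $(R\in D)$ with $d_{S_i}=\alpha_i$, with $d_R$ in the span of the vectors of the parents of $R$ for every non-source region $R$, and with $d_R=(1,1,1)$ for every terminal region $R$. $D$ is *basic* if $\mathrm{In}(e)\subseteq R$ for all $R\in D$ and $e\in R\setminus\{\mathrm{lead}(R)\}$, and every non-source region has at least two parents. For $\Theta\subseteq D$, $\mathrm{reg}(\Theta)$ is the smallest family of regions that contains $\Theta$ and every non-source region of $D$ all of whose parents it contains; $\mathrm{reg}^\circ(\Theta)=\mathrm{reg}(\Theta)\setminus\Theta$, and $\mathrm{reg}(A,B)=\mathrm{reg}(\{A,B\})$. Let $\Pi=\mathrm{reg}(S_1,S_2)\cup\mathrm{reg}(S_1,S_3)\cup\mathrm{reg}(S_2,S_3)$. Let $D^{**}$ be a basic region decomposition of $G$ with exactly three terminal regions $T_1,T_2,T_3$, none of which lies in $\Pi$. For $I\subseteq\{1,2,3\}$ let $\Omega_I$ be the set of all $R\in D^{**}\setminus\Pi$ such that $R\to T_j$ holds exactly for the $j\in I$, and let $\Lambda_I$ be the set of all $Q\in\Pi$ that have a child in $\Omega_I$;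 write $\Lambda_j=\Lambda_{\{j\}}$. Call $\mathrm{RG}(D^{**})$ *terminal-separable* if $\Omega_I=\emptyset$ whenever $|I|>1$. **Theorem.** $\mathrm{RG}(D^{**})$ is not feasible if and only if it is terminal-separable and the following condition holds: (C-IR) after a suitable renumbering of the source regions $S_1,S_2,S_3$ and a suitable (independent) renumbering of the terminal regions $T_1,T_2,T_3$, there are $P_1\in\mathrm{reg}^\circ(S_2,S_3)$ and $P_2\in\mathrm{reg}^\circ(S_1,S_2)$ such that $\Lambda_1=\{S_1,P_1\}$, $\Lambda_2=\{P_1,P_2\}$ and $\Lambda_3\subseteq\mathrm{reg}(S_1,P_2)\cup\mathrm{reg}(S_1,S_3)$. Likewise, $G$ is not solvable if and only if $\mathrm{RG}(D^{**})$ is terminal-separable and (C-IR) holds. -/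

import Mathlib

/-- A `k`-source `n`-terminal sum-network: a directed acyclic (multi)graph with nodes `V` and
(ordinary) links `E`, distinct sources and distinct terminals. Finiteness of `V` and `E` is
imposed where the structure is used. -/
structure SumNetwork (V E : Type*) (k n : ℕ) where
  /-- the node a link leaves -/
  tail : E → V
  /-- the node a link enters -/
  head : E → V
  /-- the node generating the message `X_i` -/
  source : Fin k → V
  /-- the nodes demanding the sum of all messages -/
  terminal : Fin n → V
  source_injective : Function.Injective source
  terminal_injective : Function.Injective terminal
  acyclic : ∀ v, ¬ Relation.TransGen (fun u w => ∃ e, tail e = u ∧ head e = w) v v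

/-- All links of a sum-network: the ordinary ones, one imaginary incoming link for each source and
one imaginary outgoing link for each terminal. -/
inductive Link (E : Type*) (k n : ℕ)
  | ordinary (e : E)
  | source (i : Fin k)
  | terminal (j : Fin n)

namespace SumNetwork

variable {V E : Type*} {k n : ℕ} (G : SumNetwork V E k n)

/-- The tail of a link; source links have none. -/
def tail? : Link E k n → Option V
  | .ordinary e => some (G.tail e)
  | .source _ => none
  | .terminal j => some (G.terminal j)

/-- The head of a link; terminal links have none. -/
def head? : Link E k n → Option V
  | .ordinary e => some (G.head e)
  | .source i => some (G.source i)
  | .terminal _ => none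

/-- The incoming links of a link `e`: the links whose head is the tail of `e`. -/
def inLinks (e : Link E k n) : Set (Link E k n) :=
  {e' | ∃ v, G.head? e' = some v ∧ G.tail? e = some v}

/-! ### Linear network codes -/

/-- A linear solution of the network: source links carry the unit vectors, every non-source link
carries a vector in the span of its incoming links, terminal links carry the all-one vector. -/
structure IsLinearSolution {F : Type*} [Field F] (d : Link E k n → Fin k → F) : Prop where
  source : ∀ i, d (.source i) = Pi.single i 1
  nonsource : ∀ e, (∀ i, e ≠ .source i) → d e ∈ Submodule.span F (d '' G.inLinks e)
  terminal : ∀ j, d (.terminal j) = 1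

/-- The network has a linear solution over some finite field. -/
def Solvable : Prop :=
  ∃ (F : Type) (_ : Field F) (_ : Finite F) (d : Link E k n → Fin k → F), G.IsLinearSolution d

/-! ### Regions and region graphs -/

/-- `l` is a leader of the set of links `R`: it lies in `R`, and every other link of `R` has an
incoming link in `R`. (By acyclicity there is at most one leader.) -/
def IsLeader (R : Set (Link E k n)) (l : Link E k n) : Prop :=
  l ∈ R ∧ ∀ e ∈ R, e ≠ l → (G.inLinks e ∩ R).Nonempty

/-- A region is a (non-empty) set of links with a leader. -/
def IsRegion (R : Set (Link E k n)) : Prop := ∃ l, G.IsLeader R l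

/-- A partition of the set of all links into regions. -/
def IsRegionDecomposition (D : Set (Set (Link E k n))) : Prop :=
  Setoid.IsPartition D ∧ ∀ R ∈ D, G.IsRegion R

/-- `R` is the `X_i` source region: its leader is the `X_i` source link. -/
def IsSourceRegionOf (i : Fin k) (R : Set (Link E k n)) : Prop := G.IsLeader R (.source i)

/-- `R` is a source region. -/
def IsSourceRegion (R : Set (Link E k n)) : Prop := ∃ i, G.IsSourceRegionOf i R

/-- `R` contains a terminal link. -/
def IsTerminalRegion (R : Set (Link E k n)) : Prop := ∃ j, Link.terminal j ∈ R

/-- The parents of `R` in the region graph `RG(D)`: the members of `D` that contain an incoming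
link of the leader of `R`. -/
def parents (D : Set (Set (Link E k n))) (R : Set (Link E k n)) : Set (Set (Link E k n)) :=
  {R' | R' ∈ D ∧ ∃ l, G.IsLeader R l ∧ (R' ∩ G.inLinks l).Nonempty}

/-- `R' → R`: there is a (possibly trivial) directed path from `R'` to `R` in `RG(D)`. -/
def Connected (D : Set (Set (Link E k n))) (R' R : Set (Link E k n)) : Prop :=
  Relation.ReflTransGen (fun A B => A ∈ G.parents D B) R' R

/-- Basic region decompositions. -/
structure IsBasicRegionDecomposition (D : Set (Set (Link E k n))) : Prop where
  isRegionDecomposition : G.IsRegionDecomposition D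
  inLinks_subset : ∀ R ∈ D, ∀ l, G.IsLeader R l → ∀ e ∈ R, e ≠ l → G.inLinks e ⊆ R
  two_parents : ∀ R ∈ D, ¬ G.IsSourceRegion R → (G.parents D R).Nontrivial

/-- A linear solution of the region graph `RG(D)` (values of `d` outside `D` are irrelevant). -/
structure IsRegionSolution (D : Set (Set (Link E k n))) {F : Type*} [Field F]
    (d : Set (Link E k n) → Fin k → F) : Prop where
  source : ∀ R ∈ D, ∀ i, G.IsSourceRegionOf i R → d R = Pi.single i 1
  nonsource : ∀ R ∈ D, ¬ G.IsSourceRegion R → d R ∈ Submodule.span F (d '' G.parents D R)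
  terminal : ∀ R ∈ D, IsTerminalRegion R → d R = 1

/-- `RG(D)` has a linear solution over some finite field. -/
def Feasible (D : Set (Set (Link E k n))) : Prop :=
  ∃ (F : Type) (_ : Field F) (_ : Finite F) (d : Set (Link E k n) → Fin k → F),
    G.IsRegionSolution D d

/-! ### Super regions -/

/-- Membership in the super region generated by `Θ`: the least family containing `Θ` and every
non-source region all of whose parents it contains. (Source regions have no parents; they belong
to the super region only if they belong to `Θ`.) -/
inductive InSuperRegion (D Θ : Set (Set (Link E k n))) : Set (Link E k n) → Prop
  | base {R : Set (Link E k n)} (h : R ∈ Θ) : InSuperRegion D Θ R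
  | step {R : Set (Link E k n)} (hR : R ∈ D) (hns : ¬ G.IsSourceRegion R)
      (hp : ∀ R' ∈ G.parents D R, InSuperRegion D Θ R') : InSuperRegion D Θ R

/-- The super region `reg(Θ)`. -/
def reg (D Θ : Set (Set (Link E k n))) : Set (Set (Link E k n)) := {R | G.InSuperRegion D Θ R}

/-- `reg°(Θ) = reg(Θ) \ Θ`. -/
def regInt (D Θ : Set (Set (Link E k n))) : Set (Set (Link E k n)) := G.reg D Θ \ Θ

end SumNetwork

namespace SumNetwork

variable {V E : Type*} {n m : ℕ} (G : SumNetwork V E 3 n)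

/-! ### Three sources

`S i` stands for the `X_i` source region and `T 0, …, T (m - 1)` for the terminal regions. -/

/-- `Π = reg(S₁,S₂) ∪ reg(S₁,S₃) ∪ reg(S₂,S₃)`. -/
def bigPi (D : Set (Set (Link E 3 n))) (S : Fin 3 → Set (Link E 3 n)) :
    Set (Set (Link E 3 n)) :=
  G.reg D {S 0, S 1} ∪ G.reg D {S 0, S 2} ∪ G.reg D {S 1, S 2}

/-- `Ω_I`: the regions outside `Π` that are connected to `T j` exactly for the `j ∈ I`. -/
def Omega (D : Set (Set (Link E 3 n))) (S : Fin 3 → Set (Link E 3 n))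
    (T : Fin m → Set (Link E 3 n)) (I : Finset (Fin m)) : Set (Set (Link E 3 n)) :=
  {R | R ∈ D \ G.bigPi D S ∧ ∀ j, G.Connected D R (T j) ↔ j ∈ I}

/-- `Λ_I`: the regions in `Π` that have a child in `Ω_I`. -/
def Lambda (D : Set (Set (Link E 3 n))) (S : Fin 3 → Set (Link E 3 n))
    (T : Fin m → Set (Link E 3 n)) (I : Finset (Fin m)) : Set (Set (Link E 3 n)) :=
  {Q | Q ∈ G.bigPi D S ∧ ∃ R ∈ G.Omega D S T I, Q ∈ G.parents D R}

/-- `RG(D)` is terminal-separable. -/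
def TerminalSeparable (D : Set (Set (Link E 3 n))) (S : Fin 3 → Set (Link E 3 n))
    (T : Fin m → Set (Link E 3 n)) : Prop :=
  ∀ I : Finset (Fin m), 1 < I.card → G.Omega D S T I = ∅

/-- Condition (C-IR); the renamings of the source regions and of the terminal regions are the
permutations `σ` and `τ`. -/
def CIR (D : Set (Set (Link E 3 n))) (S : Fin 3 → Set (Link E 3 n))
    (T : Fin 3 → Set (Link E 3 n)) : Prop :=
  ∃ σ τ : Equiv.Perm (Fin 3),
    ∃ P₁ ∈ G.regInt D {S (σ 1), S (σ 2)}, ∃ P₂ ∈ G.regInt D {S (σ 0), S (σ 1)},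
      G.Lambda D S T {τ 0} = {S (σ 0), P₁} ∧
      G.Lambda D S T {τ 1} = {P₁, P₂} ∧
      G.Lambda D S T {τ 2} ⊆ G.reg D {S (σ 0), P₂} ∪ G.reg D {S (σ 0), S (σ 2)}

end SumNetwork

/-! Vectors on `side i` have `i`-th coordinate zero. Projectively, the sides are the sides of the
coordinate triangle, the sources are its corners, and the all-one point lies on none of them. A
color stands for a line through the all-one point; a vertex inside `side i` is placed where the line
of its color meets that side. Two points of one side with different colors span the side, so the
only constraint on a coloring is that parents of a single color force that color. The all-one vector
is spanned by points of equal color on two sides, away from their common corner, or by two points of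
one side and a point off it (`boundaryCode_mem_span`, `Good.one_mem_span`).

Outside the boundary nothing obstructs: `exists_flow` delivers at `x` any vector in the span of
`frontier x`. If the terminals have disjoint sets of ancestors, a coloring good for the three
frontiers therefore suffices, and `hasGoodColoring_or_exceptional` shows that only the configuration
of (C-IR) prevents one. If two terminals share an ancestor, they are served through it; then two of
the three sets coincide, whereas the exceptional sets are pairwise different.

Conversely, in the exceptional configuration `{S₁, P₁}` makes the vector of `P₁` proportional to
`(0,1,1)`, then `{P₁, P₂}` makes that of `P₂` proportional to `α₁`, and everything feeding the third
terminal has second coordinate zero (`IsCode.not_exceptional`). This holds over every field.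

Solvability reduces to feasibility because in a basic decomposition all links of a region carry
multiples of the leader's vector. -/

/-- A well-founded parent relation with three sources in which every inner vertex has at least
two parents. -/
structure RegionSystem (α : Type*) where
  /-- the parents of a vertex -/
  par : α → Set α
  /-- the non-source vertices -/
  inner : Set α
  /-- the sources -/
  src : Fin 3 → α
  wf : WellFounded fun a b => a ∈ par b
  src_injective : Function.Injective src
  src_notMem : ∀ i, src i ∉ inner
  par_src : ∀ i, par (src i) = ∅
  mem_of_par : ∀ {a b}, a ∈ par b → a ∈ inner ∨ ∃ i, a = src i
  nontrivial : ∀ b ∈ inner, (par b).Nontrivial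

/-! ### Super regions, sides and the boundary. -/

namespace RegionSystem

variable {α : Type*} (Y : RegionSystem α)

/-- Membership in the smallest family that contains `Θ` and every inner vertex all of whose parents
it contains. -/
inductive InClosure (Θ : Set α) : α → Prop
  | base {x : α} (h : x ∈ Θ) : InClosure Θ x
  | step {x : α} (hx : x ∈ Y.inner) (hp : ∀ a ∈ Y.par x, InClosure Θ a) : InClosure Θ x

/-- The super region generated by `Θ`. -/
def closure (Θ : Set α) : Set α := {x | Y.InClosure Θ x}

/-- The super region generated by the two sources other than `src i`. -/
def side (i : Fin 3) : Set α := Y.closure (Y.src '' {i}ᶜ)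

/-- The non-source vertices of `side i`. -/
def int (i : Fin 3) : Set α := {x | x ∈ Y.side i ∧ ∀ j, x ≠ Y.src j}

/-- The union of the three sides. -/
def boundary : Set α := {x | ∃ i, x ∈ Y.side i}

variable {Y}

theorem subset_closure (Θ : Set α) : Θ ⊆ Y.closure Θ := fun _ h => .base h

theorem mem_closure_iff {Θ : Set α} {x : α} :
    x ∈ Y.closure Θ ↔ x ∈ Θ ∨ x ∈ Y.inner ∧ Y.par x ⊆ Y.closure Θ := by
  constructor
  · rintro (h | ⟨h, h'⟩)
    · exact .inl h
    · exact .inr ⟨h, h'⟩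
  · rintro (h | ⟨h, h'⟩)
    · exact .base h
    · exact InClosure.step h h'

theorem closure_subset {Θ C : Set α} (h : Θ ⊆ C)
    (hC : ∀ x ∈ Y.inner, Y.par x ⊆ C → x ∈ C) : Y.closure Θ ⊆ C := by
  intro x hx
  induction hx with
  | base hx => exact h hx
  | step hx _ ih => exact hC _ hx ih

theorem src_mem_closure {Θ : Set α} {i : Fin 3} (h : Y.src i ∈ Y.closure Θ) : Y.src i ∈ Θ :=
  (mem_closure_iff.1 h).resolve_right fun h' => Y.src_notMem i h'.1

theorem src_mem_side {i j : Fin 3} : Y.src j ∈ Y.side i ↔ j ≠ i := by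
  constructor
  · intro h
    obtain ⟨k, hk, e⟩ := src_mem_closure h
    exact Y.src_injective e ▸ hk
  · exact fun h => subset_closure _ ⟨j, h, rfl⟩

theorem mem_inner_of_mem_int {i : Fin 3} {x : α} (h : x ∈ Y.int i) : x ∈ Y.inner := by
  rcases mem_closure_iff.1 h.1 with ⟨j, _, e⟩ | h'
  · exact absurd e.symm (h.2 j)
  · exact h'.1

theorem par_subset_side {i : Fin 3} {x : α} (h : x ∈ Y.int i) : Y.par x ⊆ Y.side i := by
  rcases mem_closure_iff.1 h.1 with ⟨j, _, e⟩ | h'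
  · exact absurd e.symm (h.2 j)
  · exact h'.2

theorem mem_side_cases {i : Fin 3} {x : α} (h : x ∈ Y.side i) :
    (∃ j, j ≠ i ∧ x = Y.src j) ∨ x ∈ Y.int i := by
  by_cases hx : ∃ j, x = Y.src j
  · obtain ⟨j, rfl⟩ := hx
    exact .inl ⟨j, src_mem_side.1 h, rfl⟩
  · exact .inr ⟨h, fun j e => hx ⟨j, e⟩⟩

/-- By induction, two distinct parents of a non-source would be two distinct sources common to both
sides, but two sides share only one source. Hence the interiors of the sides are disjoint and can be
colored independently. -/
theorem exists_eq_src_of_mem_two_sides {i j : Fin 3} (hij : i ≠ j) {x : α} (hi : x ∈ Y.side i)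
    (hj : x ∈ Y.side j) : ∃ k, x = Y.src k := by
  induction x using Y.wf.induction with
  | _ x ih =>
    rcases mem_side_cases hi with ⟨k, _, e⟩ | hx
    · exact ⟨k, e⟩
    rcases mem_side_cases hj with ⟨k, _, e⟩ | hx'
    · exact ⟨k, e⟩
    obtain ⟨a, ha, b, hb, hab⟩ := Y.nontrivial x (mem_inner_of_mem_int hx)
    have ha1 := par_subset_side hx ha
    have ha2 := par_subset_side hx' ha
    have hb1 := par_subset_side hx hb
    have hb2 := par_subset_side hx' hb
    obtain ⟨k, rfl⟩ := ih a ha ha1 ha2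
    obtain ⟨l, rfl⟩ := ih b hb hb1 hb2
    rw [src_mem_side] at *
    have : k ≠ l := fun h => hab (h ▸ rfl)
    omega

theorem notMem_side_of_mem_int {i j : Fin 3} (hij : i ≠ j) {x : α} (h : x ∈ Y.int i) :
    x ∉ Y.side j := fun hj => by
  obtain ⟨k, e⟩ := exists_eq_src_of_mem_two_sides hij h.1 hj
  exact h.2 k e

theorem eq_of_mem_int {i j : Fin 3} {x : α} (hi : x ∈ Y.int i) (hj : x ∈ Y.int j) : i = j := by
  by_contra h
  exact notMem_side_of_mem_int h hi hj.1

theorem src_mem_boundary (i : Fin 3) : Y.src i ∈ Y.boundary :=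
  ⟨i + 1, src_mem_side.2 (by omega)⟩

theorem mem_boundary_cases {x : α} (h : x ∈ Y.boundary) :
    (∃ i, x = Y.src i) ∨ ∃ i, x ∈ Y.int i := by
  obtain ⟨i, h⟩ := h
  rcases mem_side_cases h with ⟨j, _, e⟩ | h
  · exact .inl ⟨j, e⟩
  · exact .inr ⟨i, h⟩

/-! ### Colorings -/

/-- Colors: one for each source, one spare color, and a private color for every vertex. -/
inductive Color (α : Type*)
  | corner (i : Fin 3)
  | generic
  | own (a : α)

open Color

variable (Y) in
/-- A coloring of the boundary that is realizable by vectors. -/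
structure IsColoring (c : α → Color α) : Prop where
  src : ∀ i, c (Y.src i) = corner i
  int : ∀ i, ∀ x ∈ Y.int i, ∀ t, (∀ a ∈ Y.par x, c a = t) → c x = t

variable (Y) in
/-- The coloring that agrees with `g i` on `int i`. -/
noncomputable def glue (g : Fin 3 → α → Color α) (x : α) : Color α :=
  open Classical in
  if h : ∃ i, x = Y.src i then corner h.choose
  else if h : ∃ i, x ∈ Y.int i then g h.choose x else generic

theorem glue_src (g : Fin 3 → α → Color α) (i : Fin 3) : Y.glue g (Y.src i) = corner i := by
  have h : ∃ j, Y.src i = Y.src j := ⟨i, rfl⟩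
  rw [glue, dif_pos h]
  exact congrArg _ (Y.src_injective h.choose_spec).symm

theorem glue_int (g : Fin 3 → α → Color α) {i : Fin 3} {x : α} (hx : x ∈ Y.int i) :
    Y.glue g x = g i x := by
  have h : ∃ i, x ∈ Y.int i := ⟨i, hx⟩
  rw [glue, dif_neg (fun ⟨j, e⟩ => hx.2 j e), dif_pos h, eq_of_mem_int h.choose_spec hx]

/-- Distinct sources have distinct colors, so if all parents share a color, one of them is in `int
i` and the shared color is `q`. -/
theorem color_const {c : α → Color α} (hc : ∀ i, c (Y.src i) = corner i) {i : Fin 3} {q : Color α}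
    (hq : ∀ x ∈ Y.int i, c x = q) {x : α} (hx : x ∈ Y.int i) {t : Color α}
    (h : ∀ a ∈ Y.par x, c a = t) : c x = t := by
  obtain ⟨a, ha, b, hb, hab⟩ := Y.nontrivial x (mem_inner_of_mem_int hx)
  rcases mem_side_cases (par_subset_side hx ha) with ⟨j, _, rfl⟩ | ha'
  · rcases mem_side_cases (par_subset_side hx hb) with ⟨k, _, rfl⟩ | hb'
    · have := (h _ ha).trans (h _ hb).symm
      rw [hc, hc, corner.injEq] at this
      exact absurd (this ▸ rfl) hab
    · rw [hq x hx, ← hq b hb', h b hb]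
  · rw [hq x hx, ← hq a ha', h a ha]

/-- Merging the colors of a set `Q` closed under the forcing rule, and no others, is realizable:
parents sharing a color either all lie in `Q`, or would violate injectivity outside it. -/
theorem color_class {c : α → Color α} {i : Fin 3} {Q : Set α} {q : Color α}
    (hQ : ∀ x ∈ Y.int i, Y.par x ⊆ Q → x ∈ Q) (hq : ∀ x ∈ Y.side i, x ∈ Q → c x = q)
    (hq' : ∀ x ∈ Y.side i, c x = q → x ∈ Q) (hinj : Set.InjOn c (Y.side i \ Q))
    {x : α} (hx : x ∈ Y.int i) {t : Color α}
    (h : ∀ a ∈ Y.par x, c a = t) : c x = t := by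
  obtain ⟨a, ha, b, hb, hab⟩ := Y.nontrivial x (mem_inner_of_mem_int hx)
  have hp := par_subset_side hx
  by_cases hxq : t = q
  · subst hxq
    exact hq x hx.1 (hQ x hx fun y hy => hq' y (hp hy) (h y hy))
  · refine absurd (hinj ⟨hp ha, fun h' => hxq ?_⟩ ⟨hp hb, fun h' => hxq ?_⟩
      ((h a ha).trans (h b hb).symm)) hab
    · rw [← h a ha, hq a (hp ha) h']
    · rw [← h b hb, hq b (hp hb) h']

variable (Y) in
/-- Sufficient conditions for the all-one vector to lie in the span of the vectors of `L`. -/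
def Good (c : α → Color α) (L : Set α) : Prop :=
  (∃ i j k : Fin 3, i ≠ j ∧ j ≠ k ∧ i ≠ k ∧ ∃ x ∈ L, ∃ y ∈ L, x ∈ Y.side i ∧ y ∈ Y.side j ∧
    c x = c y ∧ c x ≠ corner k) ∨
  (∃ i j k : Fin 3, i ≠ j ∧ j ≠ k ∧ i ≠ k ∧ ∃ x ∈ L, ∃ y ∈ L, ∃ z ∈ L,
    x ∈ Y.side i ∧ y ∈ Y.side i ∧ z ∈ Y.side j ∧ c x ≠ c y ∧ c z ≠ corner k)

theorem forall_fin_three {p : Fin 3 → Prop} {i j k : Fin 3} (hij : i ≠ j) (hjk : j ≠ k)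
    (hik : i ≠ k) (hi : p i) (hj : p j) (hk : p k) (l : Fin 3) : p l := by
  have : l = i ∨ l = j ∨ l = k := by omega
  rcases this with rfl | rfl | rfl <;> assumption

theorem exists_off_side {L : Set α} (hL : L ⊆ Y.boundary) {i j k : Fin 3} (hij : i ≠ j)
    (hjk : j ≠ k) (hik : i ≠ k) (hs : ¬ L ⊆ Y.side i) :
    Y.src i ∈ L ∨ (L ∩ Y.int j).Nonempty ∨ (L ∩ Y.int k).Nonempty := by
  obtain ⟨x, hx, hx'⟩ := Set.not_subset.1 hs
  rcases mem_boundary_cases (hL hx) with ⟨l, rfl⟩ | ⟨l, hl⟩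
  · have : l = i := by
      by_contra h
      exact hx' (src_mem_side.2 h)
    exact .inl (this ▸ hx)
  · have h1 : l ≠ i := fun h => hx' (h ▸ hl.1)
    have : l = j ∨ l = k := by omega
    rcases this with rfl | rfl
    · exact .inr (.inl ⟨x, hx, hl⟩)
    · exact .inr (.inr ⟨x, hx, hl⟩)

/-! ### Criteria for a coloring to be good for one set. -/

section Good

variable {c : α → Color α} {L : Set α} {i j k : Fin 3}

theorem good_pair (hij : i ≠ j) (hjk : j ≠ k) (hik : i ≠ k) {x y : α} (hx : x ∈ L) (hy : y ∈ L)
    (hxi : x ∈ Y.side i) (hyj : y ∈ Y.side j) (h : c x = c y) (h' : c x ≠ corner k) :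
    Y.Good c L :=
  .inl ⟨i, j, k, hij, hjk, hik, x, hx, y, hy, hxi, hyj, h, h'⟩

theorem good_triple (hij : i ≠ j) (hjk : j ≠ k) (hik : i ≠ k) {x y z : α} (hx : x ∈ L)
    (hy : y ∈ L) (hz : z ∈ L) (hxi : x ∈ Y.side i) (hyi : y ∈ Y.side i) (hzj : z ∈ Y.side j)
    (h : c x ≠ c y) (h' : c z ≠ corner k) : Y.Good c L :=
  .inr ⟨i, j, k, hij, hjk, hik, x, hx, y, hy, z, hz, hxi, hyi, hzj, h, h'⟩

/-- The corner `src i` lies on the other two sides, so it pairs with a point of `int i` on the line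
joining that corner to the all-one point. -/
theorem good_median (hij : i ≠ j) (hjk : j ≠ k) (hik : i ≠ k)
    (hc : ∀ i, c (Y.src i) = corner i) {x : α} (hi : Y.src i ∈ L) (hx : x ∈ L)
    (hxi : x ∈ Y.int i) (h : c x = corner i) : Y.Good c L :=
  good_pair hij hjk hik hx hi hxi.1 (src_mem_side.2 hij) (h.trans (hc i).symm)
    (by rw [h]; simpa using hik)

/-- `src j` and `x` are different points of `side i`, and `src i` is off that side. -/
theorem good_src_src (hij : i ≠ j) (hjk : j ≠ k) (hik : i ≠ k)
    (hc : ∀ i, c (Y.src i) = corner i) {x : α} (hi : Y.src i ∈ L) (hj : Y.src j ∈ L) (hx : x ∈ L)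
    (hxi : x ∈ Y.side i) (h : c x ≠ corner j) : Y.Good c L :=
  good_triple hik hjk.symm hij hx hj hi hxi (src_mem_side.2 hij.symm)
    (src_mem_side.2 hik) (by rwa [hc]) (by rw [hc]; simpa using hij)

theorem good_corners (hij : i ≠ j) (hjk : j ≠ k) (hik : i ≠ k)
    (hc : ∀ i, c (Y.src i) = corner i) (hi : Y.src i ∈ L) (hj : Y.src j ∈ L) (hk : Y.src k ∈ L) :
    Y.Good c L :=
  good_src_src hij hjk hik hc hi hj hk (src_mem_side.2 hik.symm)
    (by rw [hc]; simpa using hjk.symm)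

variable (Y) in
/-- `L` consists of the source `src i` and vertices of the opposite side. -/
def Median (i : Fin 3) (L : Set α) : Prop :=
  Y.src i ∈ L ∧ (L ∩ Y.int i).Nonempty ∧ L ⊆ insert (Y.src i) (Y.int i)

variable (Y) in
/-- `L` consists of vertices of `int i` and `int j`. -/
def Mixed (i j : Fin 3) (L : Set α) : Prop :=
  (L ∩ Y.int i).Nonempty ∧ (L ∩ Y.int j).Nonempty ∧ L ⊆ Y.int i ∪ Y.int j

theorem Mixed.symm (h : Y.Mixed i j L) : Y.Mixed j i L :=
  ⟨h.2.1, h.1, Set.union_comm _ _ ▸ h.2.2⟩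

theorem median_or_src (hij : i ≠ j) (hjk : j ≠ k) (hik : i ≠ k) (hL : L ⊆ Y.boundary)
    (hs : ¬ L ⊆ Y.side i) (hi : (L ∩ Y.int i).Nonempty) (hj : ¬ (L ∩ Y.int j).Nonempty)
    (hk : ¬ (L ∩ Y.int k).Nonempty) :
    Y.src i ∈ L ∧ (Y.Median i L ∨ Y.src j ∈ L ∨ Y.src k ∈ L) := by
  have hi' : Y.src i ∈ L := by
    rcases exists_off_side hL hij hjk hik hs with h | h | h
    exacts [h, absurd h hj, absurd h hk]
  refine ⟨hi', ?_⟩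
  by_contra! h
  refine h.1 ⟨hi', hi, fun x hx => ?_⟩
  rcases mem_boundary_cases (hL hx) with ⟨l, rfl⟩ | ⟨l, hl⟩
  · refine forall_fin_three (p := fun l => Y.src l ∈ L → Y.src l ∈ insert (Y.src i) (Y.int i))
      hij hjk hik (fun _ => .inl rfl) (fun h' => absurd h' h.2.1) (fun h' => absurd h' h.2.2) l hx
  · refine forall_fin_three (p := fun l => x ∈ Y.int l → x ∈ insert (Y.src i) (Y.int i))
      hij hjk hik .inr (fun h' => absurd ⟨x, hx, h'⟩ hj) (fun h' => absurd ⟨x, hx, h'⟩ hk) l hl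

theorem mixed_or_src (hij : i ≠ j) (hjk : j ≠ k) (hik : i ≠ k) (hL : L ⊆ Y.boundary)
    (hi : (L ∩ Y.int i).Nonempty) (hj : (L ∩ Y.int j).Nonempty) (hk : ¬ (L ∩ Y.int k).Nonempty) :
    Y.Mixed i j L ∨ Y.src i ∈ L ∨ Y.src j ∈ L ∨ Y.src k ∈ L := by
  by_contra! h
  refine h.1 ⟨hi, hj, fun x hx => ?_⟩
  rcases mem_boundary_cases (hL hx) with ⟨l, rfl⟩ | ⟨l, hl⟩
  · exact absurd hx (forall_fin_three (p := fun l => Y.src l ∉ L) hij hjk hik h.2.1 h.2.2.1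
      h.2.2.2 l)
  · refine forall_fin_three (p := fun l => x ∈ Y.int l → x ∈ Y.int i ∪ Y.int j)
      hij hjk hik .inl .inr (fun h' => absurd ⟨x, hx, h'⟩ hk) l hl

theorem good_of_no_int (hij : i ≠ j) (hjk : j ≠ k) (hik : i ≠ k)
    (hc : ∀ i, c (Y.src i) = corner i) (hL : L ⊆ Y.boundary)
    (hs : ∀ i, ¬ L ⊆ Y.side i) (hi : ¬ (L ∩ Y.int i).Nonempty) (hj : ¬ (L ∩ Y.int j).Nonempty)
    (hk : ¬ (L ∩ Y.int k).Nonempty) : Y.Good c L := by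
  have h1 := exists_off_side hL hij hjk hik (hs i)
  have h2 := exists_off_side hL hij.symm hik hjk (hs j)
  have h3 := exists_off_side hL hik.symm hij hjk.symm (hs k)
  exact good_corners hij hjk hik hc (by tauto) (by tauto) (by tauto)

theorem good_of_corner (hij : i ≠ j) (hjk : j ≠ k) (hik : i ≠ k)
    (hc : ∀ i, c (Y.src i) = corner i) (hg : ∀ l, ∀ x ∈ Y.int l, c x = corner i)
    (hL : L ⊆ Y.boundary) (hs : ∀ i, ¬ L ⊆ Y.side i)
    (h : (L ∩ Y.int i).Nonempty ∨ Y.src j ∈ L ∧ Y.src k ∈ L) : Y.Good c L := by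
  have off := exists_off_side hL hij hjk hik (hs i)
  rcases h with ⟨x, hx, hxi⟩ | ⟨hj, hk⟩
  · rcases off with h | ⟨y, hy, hyj⟩ | ⟨y, hy, hyk⟩
    · exact good_median hij hjk hik hc h hx hxi (hg _ _ hxi)
    · exact good_pair hij hjk hik hx hy hxi.1 hyj.1 (by rw [hg _ _ hxi, hg _ _ hyj])
        (by rw [hg _ _ hxi]; simpa using hik)
    · exact good_pair hik hjk.symm hij hx hy hxi.1 hyk.1 (by rw [hg _ _ hxi, hg _ _ hyk])
        (by rw [hg _ _ hxi]; simpa using hij)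
  · rcases off with h | ⟨y, hy, hyj⟩ | ⟨y, hy, hyk⟩
    · exact good_corners hij hjk hik hc h hj hk
    · exact good_src_src hjk hik.symm hij.symm hc hj hk hy hyj.1
        (by rw [hg _ _ hyj]; simpa using hik)
    · exact good_src_src hjk.symm hij.symm hik.symm hc hk hj hy hyk.1
        (by rw [hg _ _ hyk]; simpa using hij)

theorem good_of_generic_aux (hij : i ≠ j) (hjk : j ≠ k) (hik : i ≠ k)
    (hc : ∀ i, c (Y.src i) = corner i)
    (hgi : ∀ x ∈ L ∩ Y.int i, c x = corner i)
    (hg : ∀ x ∈ Y.int j, c x = generic)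
    (hL : L ⊆ Y.boundary) (hs : ∀ i, ¬ L ⊆ Y.side i) (hj : (L ∩ Y.int j).Nonempty)
    (hk : ¬ (L ∩ Y.int k).Nonempty) :
    Y.Good c L ∨ Y.Median j L ∨ Y.Mixed i j L := by
  obtain ⟨x, hx, hxj⟩ := hj
  by_cases hi : (L ∩ Y.int i).Nonempty
  · have hi' := hi
    obtain ⟨y, hy, hyi⟩ := hi
    rcases mixed_or_src hij hjk hik hL hi' ⟨x, hx, hxj⟩ hk with h | h | h | h
    · exact .inr (.inr h)
    · exact .inl (good_median hij hjk hik hc h hy hyi (hgi y ⟨hy, hyi⟩))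
    · exact .inl (good_triple hij hjk hik h hy hx (src_mem_side.2 hij.symm) hyi.1 hxj.1
        (by rw [hc, hgi y ⟨hy, hyi⟩]; simpa using hij.symm) (by rw [hg x hxj]; simp))
    · exact .inl (good_triple hij hjk hik h hy hx (src_mem_side.2 hik.symm) hyi.1 hxj.1
        (by rw [hc, hgi y ⟨hy, hyi⟩]; simpa using hik.symm) (by rw [hg x hxj]; simp))
  · obtain ⟨h, h' | h' | h'⟩ := median_or_src hij.symm hik hjk hL (hs j) ⟨x, hx, hxj⟩ hi hk
    · exact .inr (.inl h')
    · exact .inl (good_src_src hij.symm hik hjk hc h h' hx hxj.1 (by rw [hg x hxj]; simp))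
    · exact .inl (good_src_src hjk hik.symm hij.symm hc h h' hx hxj.1 (by rw [hg x hxj]; simp))

/-- Isolates the shapes of `L` that may need a finer coloring than the corner color on `int i` and
the spare color elsewhere. -/
theorem good_of_generic (hij : i ≠ j) (hjk : j ≠ k) (hik : i ≠ k)
    (hc : ∀ i, c (Y.src i) = corner i)
    (hgi : ∀ x ∈ L ∩ Y.int i, c x = corner i)
    (hgj : ∀ x ∈ Y.int j, c x = generic) (hgk : ∀ x ∈ Y.int k, c x = generic)
    (hL : L ⊆ Y.boundary) (hs : ∀ i, ¬ L ⊆ Y.side i) :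
    Y.Good c L ∨ Y.Median j L ∨ Y.Median k L ∨ Y.Mixed i j L ∨ Y.Mixed i k L := by
  by_cases hj : (L ∩ Y.int j).Nonempty
  · by_cases hk : (L ∩ Y.int k).Nonempty
    · obtain ⟨x, hx, hxj⟩ := hj
      obtain ⟨y, hy, hyk⟩ := hk
      exact .inl (good_pair hjk hik.symm hij.symm hx hy hxj.1 hyk.1 (by rw [hgj x hxj, hgk y hyk])
        (by rw [hgj x hxj]; simp))
    · have := good_of_generic_aux hij hjk hik hc hgi hgj hL hs hj hk
      tauto
  · by_cases hk : (L ∩ Y.int k).Nonempty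
    · have := good_of_generic_aux hik hjk.symm hij hc hgi hgk hL hs hk hj
      tauto
    · left
      by_cases hi : (L ∩ Y.int i).Nonempty
      · obtain ⟨h, -⟩ := median_or_src hij hjk hik hL (hs i) hi hj hk
        obtain ⟨x, hx, hxi⟩ := hi
        exact good_median hij hjk hik hc h hx hxi (hgi x ⟨hx, hxi⟩)
      · exact good_of_no_int hij hjk hik hc hL hs hi hj hk

/-- The spare color matches inner vertices of any two sides. If only one side contributes inner
vertices, its opposite source is in `L`, and unless `L` is a median a second source is too. -/
theorem good_of_all_generic
    (hc : ∀ i, c (Y.src i) = corner i) (hg : ∀ l, ∀ x ∈ Y.int l, c x = generic)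
    (hL : L ⊆ Y.boundary) (hs : ∀ i, ¬ L ⊆ Y.side i) (hm : ∀ i, ¬ Y.Median i L) :
    Y.Good c L := by
  have key : ∀ i j k : Fin 3, i ≠ j → j ≠ k → i ≠ k → (L ∩ Y.int i).Nonempty → Y.Good c L := by
    rintro i j k hij hjk hik ⟨x, hx, hxi⟩
    by_cases hj : (L ∩ Y.int j).Nonempty
    · obtain ⟨y, hy, hyj⟩ := hj
      exact good_pair hij hjk hik hx hy hxi.1 hyj.1 (by rw [hg _ x hxi, hg _ y hyj])
        (by rw [hg _ x hxi]; simp)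
    by_cases hk : (L ∩ Y.int k).Nonempty
    · obtain ⟨y, hy, hyj⟩ := hk
      exact good_pair hik hjk.symm hij hx hy hxi.1 hyj.1 (by rw [hg _ x hxi, hg _ y hyj])
        (by rw [hg _ x hxi]; simp)
    obtain ⟨h, h' | h' | h'⟩ := median_or_src hij hjk hik hL (hs i) ⟨x, hx, hxi⟩ hj hk
    · exact absurd h' (hm i)
    · exact good_src_src hij hjk hik hc h h' hx hxi.1 (by rw [hg _ x hxi]; simp)
    · exact good_src_src hik hjk.symm hij hc h h' hx hxi.1 (by rw [hg _ x hxi]; simp)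
  by_cases h0 : (L ∩ Y.int 0).Nonempty
  · exact key 0 1 2 (by decide) (by decide) (by decide) h0
  by_cases h1 : (L ∩ Y.int 1).Nonempty
  · exact key 1 0 2 (by decide) (by decide) (by decide) h1
  by_cases h2 : (L ∩ Y.int 2).Nonempty
  · exact key 2 0 1 (by decide) (by decide) (by decide) h2
  exact good_of_no_int (by decide) (by decide) (by decide) hc hL hs h0 h1 h2

end Good

/-! ### Existence of good colorings -/

variable (Y) in
/-- The exceptional configuration of three subsets of the boundary. -/
def Exceptional (L : Fin 3 → Set α) : Prop :=
  ∃ i j k : Fin 3, i ≠ j ∧ j ≠ k ∧ i ≠ k ∧ ∃ t u w : Fin 3, t ≠ u ∧ u ≠ w ∧ t ≠ w ∧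
    ∃ p ∈ Y.int i, ∃ q ∈ Y.int k, L t = {Y.src i, p} ∧ L u = {p, q} ∧
      L w ⊆ Y.closure {Y.src i, q} ∪ Y.side j

variable (Y) in
/-- A coloring that is good for all three sets. -/
def HasGoodColoring (L : Fin 3 → Set α) : Prop := ∃ c, Y.IsColoring c ∧ ∀ t, Y.Good c (L t)

theorem exists_const_coloring (g : Fin 3 → Color α) :
    ∃ c, Y.IsColoring c ∧ ∀ i, ∀ x ∈ Y.int i, c x = g i :=
  ⟨Y.glue fun i _ => g i, ⟨glue_src _, fun _ _ hx _ h =>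
    color_const (glue_src _) (fun _ hy => glue_int _ hy) hx h⟩, fun _ _ hx => glue_int _ hx⟩

/-- Distinct colors on `int i`, with two of them prescribed. -/
noncomputable def twoColors (i : Fin 3) (p q x : α) : Color α :=
  open Classical in if x = p then corner i else if x = q then generic else own x

/-- Distinct colors on a side never force anything, since an inner vertex has two distinct parents.
-/
theorem color_injOn {c : α → Color α} {i : Fin 3} (hinj : Set.InjOn c (Y.side i))
    {x : α} (hx : x ∈ Y.int i) {t : Color α} (h : ∀ a ∈ Y.par x, c a = t) : c x = t := by
  obtain ⟨a, ha, b, hb, hab⟩ := Y.nontrivial x (mem_inner_of_mem_int hx)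
  have hp := par_subset_side hx
  exact absurd (hinj (hp ha) (hp hb) ((h a ha).trans (h b hb).symm)) hab

theorem color_twoColors {c : α → Color α} (hc : ∀ i, c (Y.src i) = corner i) {i : Fin 3} {p q : α}
    (hg : ∀ x ∈ Y.int i, c x = twoColors i p q x)
    {x : α} (hx : x ∈ Y.int i) {t : Color α} (h : ∀ a ∈ Y.par x, c a = t) : c x = t := by
  refine color_injOn (fun y hy z hz hyz => ?_) hx h
  rcases mem_side_cases hy with ⟨l, hl, rfl⟩ | hy'
  · rcases mem_side_cases hz with ⟨m, hm, rfl⟩ | hz'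
    · rw [hc, hc, corner.injEq] at hyz
      rw [hyz]
    · rw [hc, hg z hz', twoColors] at hyz
      split_ifs at hyz
      exact absurd (corner.inj hyz) hl
  · rcases mem_side_cases hz with ⟨m, hm, rfl⟩ | hz'
    · rw [hc, hg y hy', twoColors] at hyz
      split_ifs at hyz
      exact absurd (corner.inj hyz).symm hm
    · rw [hg y hy', hg z hz', twoColors, twoColors] at hyz
      split_ifs at hyz with h1 h2 h3 h4 h5 h6 <;> simp_all

variable (Y) in
theorem exists_glue {i j k : Fin 3} (hij : i ≠ j) (hjk : j ≠ k) (hik : i ≠ k)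
    (gi gj gk : α → Color α) : ∃ c : α → Color α,
      (∀ l, c (Y.src l) = corner l) ∧ (∀ x ∈ Y.int i, c x = gi x) ∧
      (∀ x ∈ Y.int j, c x = gj x) ∧ ∀ x ∈ Y.int k, c x = gk x := by
  refine ⟨Y.glue fun l => if l = i then gi else if l = j then gj else gk, glue_src _,
    fun x hx => ?_, fun x hx => ?_, fun x hx => ?_⟩
  · rw [glue_int _ hx, if_pos rfl]
  · rw [glue_int _ hx, if_neg hij.symm, if_pos rfl]
  · rw [glue_int _ hx, if_neg hik.symm, if_neg hjk.symm]

theorem eq_of_ne_of_ne {i j k l : Fin 3} (hij : i ≠ j) (hjk : j ≠ k) (hik : i ≠ k) (hj : l ≠ j)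
    (hk : l ≠ k) : l = i := by
  omega

/-! ### Case analysis on median and mixed sets. -/

section Cases

variable {L : Fin 3 → Set α} {i j k t u w : Fin 3}

/-- The corner colors on `p` and `q` serve the two medians, while `p'` and `q'` are free to share
the spare color for `L w`. -/
theorem hasGoodColoring_of_ne_of_ne (hij : i ≠ j) (hjk : j ≠ k) (hik : i ≠ k)
    (htu : t ≠ u) (huw : u ≠ w) (htw : t ≠ w) {p p' q q' : α} (hp : p ∈ Y.int i)
    (hp' : p' ∈ Y.int i) (hq : q ∈ Y.int k) (hq' : q' ∈ Y.int k) (hpp : p' ≠ p) (hqq : q' ≠ q)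
    (hit : Y.src i ∈ L t) (hpt : p ∈ L t) (hku : Y.src k ∈ L u) (hqu : q ∈ L u)
    (hpw : p' ∈ L w) (hqw : q' ∈ L w) : Y.HasGoodColoring L := by
  obtain ⟨c, hc, hi, hj, hk⟩ := Y.exists_glue hij hjk hik (twoColors i p p') (fun _ => generic)
    (twoColors k q q')
  refine ⟨c, ⟨hc, ?_⟩, ?_⟩
  · refine forall_fin_three hij hjk hik ?_ ?_ ?_
    · exact fun x hx _ => color_twoColors hc hi hx
    · exact fun x hx _ => color_const hc hj hx
    · exact fun x hx _ => color_twoColors hc hk hx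
  · have h1 : c p' = generic := by rw [hi p' hp', twoColors, if_neg hpp, if_pos rfl]
    have h2 : c q' = generic := by rw [hk q' hq', twoColors, if_neg hqq, if_pos rfl]
    refine forall_fin_three htu huw htw ?_ ?_ ?_
    · exact good_median hij hjk hik hc hit hpt hp (by rw [hi p hp, twoColors, if_pos rfl])
    · exact good_median hik.symm hij hjk.symm hc hku hqu hq
        (by rw [hk q hq, twoColors, if_pos rfl])
    · exact good_pair hik hjk.symm hij hpw hqw hp'.1 hq'.1 (h1.trans h2.symm) (by rw [h1]; simp)

theorem hasGoodColoring_of_ne (hij : i ≠ j) (hjk : j ≠ k) (hik : i ≠ k)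
    (htu : t ≠ u) (huw : u ≠ w) (htw : t ≠ w) {p p' q' : α} (hp : p ∈ Y.int i)
    (hp' : p' ∈ Y.int i) (hq' : q' ∈ Y.int k) (hpp : p' ≠ p)
    (hit : Y.src i ∈ L t) (hpt : p ∈ L t)
    (hpw : p' ∈ L w) (hqw : q' ∈ L w) (hL : L u ⊆ Y.boundary) (hs : ∀ i, ¬ L u ⊆ Y.side i)
    (hu : ¬ (L u ∩ Y.int i).Nonempty) (huj : ¬ Y.Median j (L u)) (huk : ¬ Y.Median k (L u)) :
    Y.HasGoodColoring L := by
  obtain ⟨c, hc, hi, hj, hk⟩ := Y.exists_glue hij hjk hik (twoColors i p p') (fun _ => generic)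
    (fun _ => generic)
  refine ⟨c, ⟨hc, ?_⟩, ?_⟩
  · refine forall_fin_three hij hjk hik ?_ ?_ ?_
    · exact fun x hx _ => color_twoColors hc hi hx
    · exact fun x hx _ => color_const hc hj hx
    · exact fun x hx _ => color_const hc hk hx
  · have h1 : c p' = generic := by rw [hi p' hp', twoColors, if_neg hpp, if_pos rfl]
    refine forall_fin_three htu huw htw ?_ ?_ ?_
    · exact good_median hij hjk hik hc hit hpt hp (by rw [hi p hp, twoColors, if_pos rfl])
    · rcases good_of_generic hij hjk hik hc (fun x hx => absurd ⟨x, hx⟩ hu) hj hk hL hs with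
        h | h | h | h | h
      · exact h
      · exact absurd h huj
      · exact absurd h huk
      · exact absurd h.1 hu
      · exact absurd h.1 hu
    · exact good_pair hik hjk.symm hij hpw hqw hp'.1 hq'.1 (by rw [h1, hk q' hq'])
        (by rw [h1]; simp)

/-- Once `p` gets the color of corner `i`, so does its closure with `src i`. The remaining freedom,
the color of `z` and the constant color of `int j`, is tuned to make `A` good. The choice `p = src
i` covers the case where only the corner itself is prescribed. -/
theorem exists_coloring_of_class (hij : i ≠ j) (hjk : j ≠ k) (hik : i ≠ k) {A : Set α} {p z : α}
    (hpj : p ≠ Y.src j) (hA : A ⊆ Y.side j ∪ Y.side k)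
    (hs : ∀ i, ¬ A ⊆ Y.side i) (hz : z ∈ A) (hzk : z ∈ Y.side k)
    (hzQ : z ∉ Y.closure {Y.src i, p}) :
    ∃ c, Y.IsColoring c ∧ (∀ x ∈ Y.int i, c x = corner i) ∧
      (∀ x ∈ Y.side k, x ∈ Y.closure {Y.src i, p} → c x = corner i) ∧
      Set.InjOn c (Y.side k \ Y.closure {Y.src i, p}) ∧ Y.Good c A := by
  classical
  set Q := Y.closure {Y.src i, p} with hQ
  have hAb : A ⊆ Y.boundary := fun x hx => (hA hx).elim (fun h => ⟨_, h⟩) fun h => ⟨_, h⟩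
  have hiQ : Y.src i ∈ Q := subset_closure _ (.inl rfl)
  have hsrcQ : ∀ l, l ≠ k → l ≠ i → Y.src l ∉ Q := by
    intro l hlk hli hl
    rcases src_mem_closure hl with h | h
    · exact hli (Y.src_injective h)
    · have : l = j := by omega
      exact hpj (this ▸ h.symm)
  -- `qz` is the color of `z` if it is in `int k`, and `qj` that of all of `int j`. Both values
  -- allowed for `qz` are new on `side k`: `src k` does not lie there.
  have key : ∀ qz qj : Color α, (qz = own z ∨ qz = corner k) → ∃ c, (∀ l, c (Y.src l) = corner l) ∧
      Y.IsColoring c ∧ (∀ x ∈ Y.int i, c x = corner i) ∧ (∀ x ∈ Y.int j, c x = qj) ∧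
      (∀ x ∈ Y.side k, x ∈ Q → c x = corner i) ∧ (z ∈ Y.int k → c z = qz) ∧
      Set.InjOn c (Y.side k \ Q) := by
    intro qz qj hqz
    obtain ⟨c, hc, hi, hj, hk⟩ := Y.exists_glue hij hjk hik (fun _ => corner i) (fun _ => qj)
      (fun x => if x ∈ Q then corner i else if x = z then qz else own x)
    have h1 : ∀ x ∈ Y.side k, x ∈ Q → c x = corner i := by
      intro x hx hxQ
      rcases mem_side_cases hx with ⟨l, hl, rfl⟩ | hx'
      · rw [hc, corner.injEq]
        by_contra hli
        exact hsrcQ l hl hli hxQ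
      · rw [hk x hx', if_pos hxQ]
    have h2 : ∀ x ∈ Y.side k, c x = corner i → x ∈ Q := by
      intro x hx hxc
      rcases mem_side_cases hx with ⟨l, hl, rfl⟩ | hx'
      · rw [hc, corner.injEq] at hxc
        exact hxc ▸ hiQ
      · by_contra hxQ
        rw [hk x hx', if_neg hxQ] at hxc
        split_ifs at hxc
        rcases hqz with rfl | rfl
        · cases hxc
        · exact hik (corner.inj hxc).symm
    have h3 : Set.InjOn c (Y.side k \ Q) := by
      rintro x ⟨hx, hxQ⟩ y ⟨hy, hyQ⟩ hxy
      rcases mem_side_cases hx with ⟨l, hl, rfl⟩ | hx'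
      · rcases mem_side_cases hy with ⟨m, hm, rfl⟩ | hy'
        · rw [hc, hc, corner.injEq] at hxy
          rw [hxy]
        · rw [hc, hk y hy', if_neg hyQ] at hxy
          split_ifs at hxy
          rcases hqz with rfl | rfl
          · cases hxy
          · exact absurd (corner.inj hxy) hl
      · rcases mem_side_cases hy with ⟨m, hm, rfl⟩ | hy'
        · rw [hc, hk x hx', if_neg hxQ] at hxy
          split_ifs at hxy
          rcases hqz with rfl | rfl
          · cases hxy
          · exact absurd (corner.inj hxy).symm hm
        · rw [hk x hx', hk y hy', if_neg hxQ, if_neg hyQ] at hxy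
          rcases hqz with rfl | rfl <;> split_ifs at hxy <;> simp_all
    refine ⟨c, hc, ⟨hc, ?_⟩, hi, hj, h1, fun hz' => ?_, h3⟩
    · refine forall_fin_three hij hjk hik ?_ ?_ ?_
      · exact fun x hx _ => color_const hc hi hx
      · exact fun x hx _ => color_const hc hj hx
      · exact fun x hx _ => color_class (fun y hy h => InClosure.step (mem_inner_of_mem_int hy) h) h1 h2 h3
          hx
    · rw [hk z hz', if_neg hzQ, if_pos rfl]
  have hAi : ∀ x ∈ A, x ∉ Y.int i := fun x hx hxi => (hA hx).elim (notMem_side_of_mem_int hij hxi)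
    (notMem_side_of_mem_int hik hxi)
  have off := exists_off_side hAb hik.symm hij hjk.symm (hs k)
  have hzk' := mem_side_cases hzk
  -- If `A` meets `int j`, that side is matched with `z`. Otherwise `A` contains `src k`, and `z`
  -- either takes its color or is the corner `src j`.
  by_cases hAj : (A ∩ Y.int j).Nonempty
  · obtain ⟨y, hy, hyj⟩ := hAj
    by_cases hzint : z ∈ Y.int k
    · obtain ⟨c, hc, hcol, hci, hcj, hcQ, hcz, hinj⟩ := key (own z) (own z) (.inl rfl)
      exact ⟨c, hcol, hci, hcQ, hinj, good_pair hjk hik.symm hij.symm hy hz hyj.1 hzk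
        (by rw [hcj y hyj, hcz hzint]) (by rw [hcj y hyj]; simp)⟩
    · obtain ⟨c, hc, hcol, hci, hcj, hcQ, hcz, hinj⟩ := key (own z) (corner j) (.inl rfl)
      obtain ⟨l, hl, rfl⟩ := hzk'.resolve_right hzint
      have : l = j := by
        by_contra h
        exact hzQ (eq_of_ne_of_ne hij hjk hik h hl ▸ hiQ)
      subst this
      exact ⟨c, hcol, hci, hcQ, hinj, good_median hij.symm hik hjk hc hz hy hyj (hcj y hyj)⟩
  · have hkA : Y.src k ∈ A := by
      rcases off with h | ⟨x, hx, hxi⟩ | h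
      exacts [h, absurd hxi (hAi x hx), absurd h hAj]
    by_cases hzint : z ∈ Y.int k
    · obtain ⟨c, hc, hcol, hci, hcj, hcQ, hcz, hinj⟩ := key (corner k) generic (.inr rfl)
      exact ⟨c, hcol, hci, hcQ, hinj,
        good_median hik.symm hij hjk.symm hc hkA hz hzint (hcz hzint)⟩
    · obtain ⟨l, hl, rfl⟩ := hzk'.resolve_right hzint
      have : l = j := by
        by_contra h
        exact hzQ (eq_of_ne_of_ne hij hjk hik h hl ▸ hiQ)
      subst this
      obtain ⟨c, hc, hcol, hci, hcj, hcQ, hcz, hinj⟩ := key (own (Y.src l)) generic (.inl rfl)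
      refine ⟨c, hcol, hci, hcQ, hinj, ?_⟩
      rcases exists_off_side hAb hij hjk hik (hs i) with h | h | ⟨x, hx, hxk⟩
      · exact good_corners hij hjk hik hc h hz hkA
      · exact absurd h hAj
      · refine good_src_src hjk.symm hij.symm hik.symm hc hkA hz hx hxk.1 fun h => ?_
        by_cases hxQ : x ∈ Q
        · rw [hcQ x hxk.1 hxQ] at h
          exact hij (corner.inj h)
        · exact hxk.2 l (hinj ⟨hxk.1, hxQ⟩ ⟨hzk, hzQ⟩ (by rw [h, hc]))

/-- The corner color on `p` makes `L t` good. For `L w` it then suffices to have two colors in `int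
k`, or a `q` in `int k` with the color of `p`. If `q` is the only candidate, its corner color
spreads over `closure {src i, q}`, and `L u` can be served if it has an element outside that closure
and `side j`. -/
theorem outcome_of_eq (hij : i ≠ j) (hjk : j ≠ k) (hik : i ≠ k)
    (htu : t ≠ u) (huw : u ≠ w) (htw : t ≠ w) (hs : ∀ i, ¬ L u ⊆ Y.side i) {p : α}
    (hp : p ∈ Y.int i) (ht : L t = {Y.src i, p}) (hpw : p ∈ L w)
    (hw : L w ⊆ insert p (Y.int k)) (hwk : (L w ∩ Y.int k).Nonempty)
    (hu : L u ⊆ Y.side j ∪ Y.side k) : Y.HasGoodColoring L ∨ Y.Exceptional L := by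
  obtain ⟨q, hqw, hq⟩ := hwk
  have hit : Y.src i ∈ L t := ht ▸ .inl rfl
  have hpt : p ∈ L t := ht ▸ .inr rfl
  by_cases h2 : ∃ q' ∈ L w, q' ∈ Y.int k ∧ q' ≠ q
  · left
    obtain ⟨q', hqw', hq', hne⟩ := h2
    obtain ⟨z, hz, hzj⟩ := Set.not_subset.1 (hs j)
    -- With `src i` repeated, the class stays in `side j`, so no vertex of `int k` is identified
    -- with another.
    have hQj : Y.closure {Y.src i, Y.src i} ⊆ Y.side j :=
      closure_subset (by rintro x (rfl | rfl) <;> exact src_mem_side.2 hij) fun x hx h => InClosure.step hx h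
    obtain ⟨c, hcol, hci, hcQ, hinj, hg⟩ := exists_coloring_of_class hij hjk hik
      (fun h => hij (Y.src_injective h)) hu hs hz ((hu hz).resolve_left hzj) fun h => hzj (hQj h)
    refine ⟨c, hcol, forall_fin_three htu huw htw ?_ hg ?_⟩
    · exact good_median hij hjk hik hcol.src hit hpt hp (hci p hp)
    · refine good_triple hik.symm hij hjk.symm hqw hqw' hpw hq.1 hq'.1 hp.1 (fun h => hne ?_)
        (by rw [hci p hp]; simpa using hij)
      exact (hinj ⟨hq.1, fun h => notMem_side_of_mem_int hjk.symm hq (hQj h)⟩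
        ⟨hq'.1, fun h => notMem_side_of_mem_int hjk.symm hq' (hQj h)⟩ h).symm
  · push Not at h2
    by_cases hex : L u ⊆ Y.closure {Y.src i, q} ∪ Y.side j
    · refine .inr ⟨i, j, k, hij, hjk, hik, t, w, u, htw, huw.symm, htu, p, hp, q, hq, ht,
        Set.Subset.antisymm (fun x hx => ?_) ?_, hex⟩
      · rcases hw hx with h | h
        · exact .inl h
        · exact .inr (h2 x hx h)
      · rintro x (rfl | rfl) <;> assumption
    · left
      obtain ⟨z, hz, hz'⟩ := Set.not_subset.1 hex
      obtain ⟨c, hcol, hci, hcQ, hinj, hg⟩ := exists_coloring_of_class hij hjk hik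
        (hq.2 j) hu hs hz ((hu hz).resolve_left fun h => hz' (.inr h)) fun h => hz' (.inl h)
      refine ⟨c, hcol, forall_fin_three htu huw htw ?_ hg ?_⟩
      · exact good_median hij hjk hik hcol.src hit hpt hp (hci p hp)
      · exact good_pair hik hjk.symm hij hpw hqw hp.1 hq.1
          (by rw [hci p hp, hcQ q hq.1 (subset_closure _ (.inr rfl))])
          (by rw [hci p hp]; simpa using hij)

theorem exists_ne_or_eq {A B I J : Set α} {s : α} (hA : A ⊆ insert s I) (hsA : s ∈ A)
    (hAI : (A ∩ I).Nonempty) (hB : B ⊆ I ∪ J) (hBI : (B ∩ I).Nonempty) :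
    (∃ p ∈ A ∩ I, ∃ p' ∈ B ∩ I, p' ≠ p) ∨ ∃ p ∈ I, A = {s, p} ∧ p ∈ B ∧ B ⊆ insert p J := by
  obtain ⟨p, hp⟩ := hAI
  obtain ⟨p', hp'⟩ := hBI
  by_cases h : ∃ p ∈ A ∩ I, ∃ p' ∈ B ∩ I, p' ≠ p
  · exact .inl h
  push Not at h
  have e : p' = p := h p hp p' hp'
  subst e
  refine .inr ⟨p', hp.2, Set.Subset.antisymm (fun x hx => ?_) ?_, hp'.1, fun x hx => ?_⟩
  · rcases hA hx with h' | h'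
    · exact .inl h'
    · exact .inr (h x ⟨hx, h'⟩ p' hp').symm
  · rintro x (rfl | rfl)
    exacts [hsA, hp.1]
  · rcases hB hx with h' | h'
    · exact .inl (h p' hp x ⟨hx, h'⟩)
    · exact .inr h'

theorem Median.subset (h : Y.Median i (L t)) {l : Fin 3} (hl : i ≠ l) :
    L t ⊆ Y.side l ∪ Y.side i := by
  intro x hx
  rcases h.2.2 hx with rfl | h'
  · exact .inl (src_mem_side.2 hl)
  · exact .inr h'.1

theorem outcome_of_median_median_mixed (hij : i ≠ j) (hjk : j ≠ k) (hik : i ≠ k)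
    (htu : t ≠ u) (huw : u ≠ w) (htw : t ≠ w) (hs : ∀ t i, ¬ L t ⊆ Y.side i)
    (ht : Y.Median i (L t)) (hu : Y.Median k (L u)) (hw : Y.Mixed i k (L w)) :
    Y.HasGoodColoring L ∨ Y.Exceptional L := by
  rcases exists_ne_or_eq ht.2.2 ht.1 ht.2.1 hw.2.2 hw.1 with
    ⟨p, hp, p', hp', hpp⟩ | ⟨p, hp, e, hpw, hw'⟩
  · rcases exists_ne_or_eq hu.2.2 hu.1 hu.2.1 hw.symm.2.2 hw.2.1 with
      ⟨q, hq, q', hq', hqq⟩ | ⟨q, hq, e, hqw, hw'⟩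
    · exact .inl (hasGoodColoring_of_ne_of_ne hij hjk hik htu huw htw hp.2 hp'.2 hq.2 hq'.2 hpp hqq
        ht.1 hp.1 hu.1 hq.1 hp'.1 hq'.1)
    · exact outcome_of_eq hjk.symm hij.symm hik.symm htu.symm htw huw (hs t) hq e hqw hw' hw.1
        (ht.subset hij)
  · exact outcome_of_eq hij hjk hik htu huw htw (hs u) hp e hpw hw' hw.2.1 (hu.subset hjk.symm)

theorem outcome_of_median_mixed (hij : i ≠ j) (hjk : j ≠ k) (hik : i ≠ k)
    (htu : t ≠ u) (huw : u ≠ w) (htw : t ≠ w) (hL : ∀ t, L t ⊆ Y.boundary)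
    (hs : ∀ t i, ¬ L t ⊆ Y.side i)
    (ht : Y.Median i (L t)) (hw : Y.Mixed i k (L w)) (hu : ¬ (L u ∩ Y.int i).Nonempty)
    (huj : ¬ Y.Median j (L u)) (huk : ¬ Y.Median k (L u)) :
    Y.HasGoodColoring L ∨ Y.Exceptional L := by
  rcases exists_ne_or_eq ht.2.2 ht.1 ht.2.1 hw.2.2 hw.1 with
    ⟨p, hp, p', hp', hpp⟩ | ⟨p, hp, e, hpw, hw'⟩
  · obtain ⟨q, hq⟩ := hw.2.1
    exact .inl (hasGoodColoring_of_ne hij hjk hik htu huw htw hp.2 hp'.2 hq.2 hpp ht.1 hp.1 hp'.1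
      hq.1 (hL u) (hs u) hu huj huk)
  · refine outcome_of_eq hij hjk hik htu huw htw (hs u) hp e hpw hw' hw.2.1 fun x hx => ?_
    rcases mem_boundary_cases (hL u hx) with ⟨l, rfl⟩ | ⟨l, hl⟩
    · by_cases h : l = j
      · exact .inr (src_mem_side.2 (h ▸ hjk))
      · exact .inl (src_mem_side.2 h)
    · exact forall_fin_three (p := fun l => x ∈ Y.int l → x ∈ Y.side j ∪ Y.side k) hij hjk hik
        (fun h => absurd ⟨x, hx, h⟩ hu) (fun h => .inl h.1) (fun h => .inr h.1) l hl

/-- Corner colors on `int i` and `int j` serve the two medians, and the color `q` of `int k` is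
chosen to suit `L w`. Only `Mixed i j` is left over and needs a finer coloring. -/
theorem outcome_of_median_median (hij : i ≠ j) (hjk : j ≠ k) (hik : i ≠ k)
    (htu : t ≠ u) (huw : u ≠ w) (htw : t ≠ w) (hL : ∀ t, L t ⊆ Y.boundary)
    (hs : ∀ t i, ¬ L t ⊆ Y.side i) (ht : Y.Median i (L t)) (hu : Y.Median j (L u)) :
    Y.HasGoodColoring L ∨ Y.Exceptional L := by
  have key : ∀ q : Color α, (∀ c, Y.IsColoring c → (∀ x ∈ Y.int i, c x = corner i) →
      (∀ x ∈ Y.int j, c x = corner j) → (∀ x ∈ Y.int k, c x = q) → Y.Good c (L w)) →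
      Y.HasGoodColoring L := by
    intro q hq
    obtain ⟨c, hc, h⟩ := Y.exists_const_coloring
      fun l => if l = i then corner i else if l = j then corner j else q
    have hi : ∀ x ∈ Y.int i, c x = corner i := fun x hx => by rw [h i x hx, if_pos rfl]
    have hj : ∀ x ∈ Y.int j, c x = corner j := fun x hx => by
      rw [h j x hx, if_neg hij.symm, if_pos rfl]
    have hk : ∀ x ∈ Y.int k, c x = q := fun x hx => by
      rw [h k x hx, if_neg hik.symm, if_neg hjk.symm]
    obtain ⟨x, hx, hxi⟩ := ht.2.1
    obtain ⟨y, hy, hyj⟩ := hu.2.1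
    exact ⟨c, hc, forall_fin_three htu huw htw
      (good_median hij hjk hik hc.src ht.1 hx hxi (hi x hxi))
      (good_median hij.symm hik hjk hc.src hu.1 hy hyj (hj y hyj)) (hq c hc hi hj hk)⟩
  have hwb := hL w
  have hws := hs w
  by_cases hi : (L w ∩ Y.int i).Nonempty <;> by_cases hj : (L w ∩ Y.int j).Nonempty
  · by_cases hk : (L w ∩ Y.int k).Nonempty
    · obtain ⟨x, hx, hxi⟩ := hi
      obtain ⟨y, hy, hyk⟩ := hk
      refine .inl (key (corner i) fun c hc hci hcj hck => ?_)
      exact good_pair hik hjk.symm hij hx hy hxi.1 hyk.1 (by rw [hci x hxi, hck y hyk])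
        (by rw [hci x hxi]; simpa using hij)
    · rcases mixed_or_src hij hjk hik hwb hi hj hk with h | h
      · exact outcome_of_median_median_mixed hik hjk.symm hij htu huw htw hs ht hu h
      · obtain ⟨x, hx, hxi⟩ := hi
        obtain ⟨y, hy, hyj⟩ := hj
        refine .inl (key generic fun c hc hci hcj hck => ?_)
        rcases h with h | h | h
        · exact good_median hij hjk hik hc.src h hx hxi (hci x hxi)
        · exact good_median hij.symm hik hjk hc.src h hy hyj (hcj y hyj)
        · exact good_triple hij hjk hik h hx hy (src_mem_side.2 hik.symm) hxi.1 hyj.1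
            (by rw [hc.src, hci x hxi]; simpa using hik.symm) (by rw [hcj y hyj]; simpa using hjk)
  · by_cases hk : (L w ∩ Y.int k).Nonempty
    · obtain ⟨x, hx, hxi⟩ := hi
      obtain ⟨y, hy, hyk⟩ := hk
      refine .inl (key (corner i) fun c hc hci hcj hck => ?_)
      exact good_pair hik hjk.symm hij hx hy hxi.1 hyk.1 (by rw [hci x hxi, hck y hyk])
        (by rw [hci x hxi]; simpa using hij)
    · obtain ⟨h, -⟩ := median_or_src hij hjk hik hwb (hws i) hi hj hk
      obtain ⟨x, hx, hxi⟩ := hi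
      exact .inl (key generic fun c hc hci _ _ =>
        good_median hij hjk hik hc.src h hx hxi (hci x hxi))
  · by_cases hk : (L w ∩ Y.int k).Nonempty
    · obtain ⟨x, hx, hxj⟩ := hj
      obtain ⟨y, hy, hyk⟩ := hk
      refine .inl (key (corner j) fun c hc hci hcj hck => ?_)
      exact good_pair hjk hik.symm hij.symm hx hy hxj.1 hyk.1 (by rw [hcj x hxj, hck y hyk])
        (by rw [hcj x hxj]; simpa using hij.symm)
    · obtain ⟨h, -⟩ := median_or_src hij.symm hik hjk hwb (hws j) hj hi hk
      obtain ⟨x, hx, hxj⟩ := hj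
      exact .inl (key generic fun c hc _ hcj _ =>
        good_median hij.symm hik hjk hc.src h hx hxj (hcj x hxj))
  · by_cases hk : (L w ∩ Y.int k).Nonempty
    · obtain ⟨h, -⟩ := median_or_src hik.symm hij hjk.symm hwb (hws k) hk hi hj
      obtain ⟨x, hx, hxk⟩ := hk
      exact .inl (key (corner k) fun c hc _ _ hck =>
        good_median hik.symm hij hjk.symm hc.src h hx hxk (hck x hxk))
    · exact .inl (key generic fun c hc _ _ _ => good_of_no_int hij hjk hik hc.src hwb hws hi hj hk)

/-- Without a median of another index, two colorings constant on each side are tried: corner `i`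
everywhere, and corner `i` on `int i` with the spare color elsewhere. A set violating the criterion
for the first misses `int i`; one failing the second is mixed and meets it. So if both fail, one of
`L u`, `L w` is mixed and the other misses `int i`. -/
theorem outcome_of_median (hij : i ≠ j) (hjk : j ≠ k) (hik : i ≠ k)
    (htu : t ≠ u) (huw : u ≠ w) (htw : t ≠ w) (hL : ∀ t, L t ⊆ Y.boundary)
    (hs : ∀ t i, ¬ L t ⊆ Y.side i) (ht : Y.Median i (L t)) :
    Y.HasGoodColoring L ∨ Y.Exceptional L := by
  by_cases h1 : Y.Median j (L u)
  · exact outcome_of_median_median hij hjk hik htu huw htw hL hs ht h1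
  by_cases h2 : Y.Median k (L u)
  · exact outcome_of_median_median hik hjk.symm hij htu huw htw hL hs ht h2
  by_cases h3 : Y.Median j (L w)
  · exact outcome_of_median_median hij hjk hik htw huw.symm htu hL hs ht h3
  by_cases h4 : Y.Median k (L w)
  · exact outcome_of_median_median hik hjk.symm hij htw huw.symm htu hL hs ht h4
  have mixed_cases : ∀ u w, t ≠ u → u ≠ w → t ≠ w → (Y.Mixed i j (L w) ∨ Y.Mixed i k (L w)) →
      ¬ (L u ∩ Y.int i).Nonempty → ¬ Y.Median j (L u) → ¬ Y.Median k (L u) →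
      Y.HasGoodColoring L ∨ Y.Exceptional L := by
    rintro u w htu huw htw (h | h) hi hj hk
    · exact outcome_of_median_mixed hik hjk.symm hij htu huw htw hL hs ht h hi hk hj
    · exact outcome_of_median_mixed hij hjk hik htu huw htw hL hs ht h hi hj hk
  by_cases hA : ∀ s, (L s ∩ Y.int i).Nonempty ∨ Y.src j ∈ L s ∧ Y.src k ∈ L s
  · obtain ⟨c, hc, h⟩ := Y.exists_const_coloring fun _ => corner i
    exact .inl ⟨c, hc, fun s => good_of_corner hij hjk hik hc.src h (hL s) (hs s) (hA s)⟩
  obtain ⟨c, hc, h⟩ := Y.exists_const_coloring fun l => if l = i then corner i else generic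
  have hci : ∀ x ∈ Y.int i, c x = corner i := fun x hx => by rw [h i x hx, if_pos rfl]
  have hcj : ∀ x ∈ Y.int j, c x = generic := fun x hx => by rw [h j x hx, if_neg hij.symm]
  have hck : ∀ x ∈ Y.int k, c x = generic := fun x hx => by rw [h k x hx, if_neg hik.symm]
  have hg : ∀ s, ¬ Y.Median j (L s) → ¬ Y.Median k (L s) →
      Y.Good c (L s) ∨ (Y.Mixed i j (L s) ∨ Y.Mixed i k (L s)) := fun s hj hk => by
    have := good_of_generic hij hjk hik hc.src (fun x hx => hci x hx.2) hcj hck (hL s) (hs s)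
    tauto
  have htg : Y.Good c (L t) := by
    obtain ⟨x, hx, hxi⟩ := ht.2.1
    exact good_median hij hjk hik hc.src ht.1 hx hxi (hci x hxi)
  have hAu : ((L u ∩ Y.int i).Nonempty ∨ Y.src j ∈ L u ∧ Y.src k ∈ L u) ∨
      ¬ (L u ∩ Y.int i).Nonempty ∧ ¬ (Y.src j ∈ L u ∧ Y.src k ∈ L u) := by tauto
  have hAw : ((L w ∩ Y.int i).Nonempty ∨ Y.src j ∈ L w ∧ Y.src k ∈ L w) ∨
      ¬ (L w ∩ Y.int i).Nonempty ∧ ¬ (Y.src j ∈ L w ∧ Y.src k ∈ L w) := by tauto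
  rcases hAu with hAu | hAu
  · rcases hAw with hAw | hAw
    · exact absurd (forall_fin_three htu huw htw (.inl ht.2.1) hAu hAw) hA
    · rcases hg u h1 h2 with hu | hu
      · rcases hg w h3 h4 with hw | hw
        · exact .inl ⟨c, hc, forall_fin_three htu huw htw htg hu hw⟩
        · exact absurd (hw.elim (·.1) (·.1)) hAw.1
      · exact mixed_cases w u htw huw.symm htu hu hAw.1 h3 h4
  · rcases hg u h1 h2 with hu | hu
    · rcases hg w h3 h4 with hw | hw
      · exact .inl ⟨c, hc, forall_fin_three htu huw htw htg hu hw⟩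
      · exact mixed_cases u w htu huw htw hw hAu.1 h1 h2
    · exact absurd (hu.elim (·.1) (·.1)) hAu.1

end Cases

theorem hasGoodColoring_or_exceptional {L : Fin 3 → Set α} (hL : ∀ t, L t ⊆ Y.boundary)
    (hs : ∀ t i, ¬ L t ⊆ Y.side i) : Y.HasGoodColoring L ∨ Y.Exceptional L := by
  by_cases h : ∃ t i, Y.Median i (L t)
  · obtain ⟨t, i, h⟩ := h
    have hd : ∀ i : Fin 3, i ≠ i + 1 ∧ i + 1 ≠ i + 2 ∧ i ≠ i + 2 := by decide
    exact outcome_of_median (hd i).1 (hd i).2.1 (hd i).2.2 (hd t).1 (hd t).2.1 (hd t).2.2 hL hs h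
  · push Not at h
    obtain ⟨c, hc, hg⟩ := Y.exists_const_coloring fun _ => generic
    exact .inl ⟨c, hc, fun t => good_of_all_generic hc.src hg (hL t) (hs t) (h t)⟩

/-- `p` separates `L w` from the other two sets, and `src i` separates those. This excludes the
exceptional case once two terminals are served through a common ancestor. -/
theorem Exceptional.injective {L : Fin 3 → Set α} (h : Y.Exceptional L) : Function.Injective L := by
  obtain ⟨i, j, k, hij, hjk, hik, t, u, w, htu, huw, htw, p, hp, q, hq, ht, hu, hw⟩ := h
  have hpw : p ∉ L w := fun h => by
    rcases hw h with h | h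
    · have hsub : Y.closure {Y.src i, q} ⊆ Y.side k :=
        closure_subset (by rintro x (rfl | rfl); exacts [src_mem_side.2 hik, hq.1])
          fun x hx h => InClosure.step hx h
      exact notMem_side_of_mem_int hik hp (hsub h)
    · exact notMem_side_of_mem_int hij hp h
  have h1 : L t ≠ L u := fun h => by
    have : Y.src i ∈ L u := h ▸ ht ▸ .inl rfl
    rw [hu] at this
    rcases this with h | h
    exacts [hp.2 i h.symm, hq.2 i h.symm]
  have h2 : L u ≠ L w := fun h => hpw (h ▸ hu ▸ .inl rfl)
  have h3 : L t ≠ L w := fun h => hpw (h ▸ ht ▸ .inr rfl)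
  intro a b hab
  have ha : a = t ∨ a = u ∨ a = w := by omega
  have hb : b = t ∨ b = u ∨ b = w := by omega
  rcases ha with rfl | rfl | rfl <;> rcases hb with rfl | rfl | rfl <;>
    first | rfl | exact absurd hab ‹_› | exact absurd hab.symm ‹_›

/-! ### Points cut out on the coordinate triangle by the lines through the all-one point. -/

section Vectors

variable {F : Type*} [Field F]

/-- The `i`-th coefficient of the line of color `t` through the all-one point; the sources have the
colors `a i`. -/
def lineCoeff (a : Fin 3 → F) (t : F) (i : Fin 3) : F := (a (i + 1) - a (i + 2)) * (t - a i)

/-- The point in which the line of color `t` meets the `i`-th side of the coordinate triangle. -/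
def sidePoint (a : Fin 3 → F) (i : Fin 3) (t : F) : Fin 3 → F :=
  Pi.single (i + 1) (lineCoeff a t (i + 2)) - Pi.single (i + 2) (lineCoeff a t (i + 1))

theorem sidePoint_apply_self (a : Fin 3 → F) (i : Fin 3) (t : F) : sidePoint a i t i = 0 := by
  fin_cases i <;> simp [sidePoint]

variable {a : Fin 3 → F} (ha : Function.Injective a)
include ha

theorem lineCoeff_ne_zero {t : F} {i : Fin 3} (h : t ≠ a i) : lineCoeff a t i ≠ 0 := by
  refine mul_ne_zero (sub_ne_zero.2 fun h => ?_) (sub_ne_zero.2 h)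
  have := ha h
  omega

theorem mem_span_sidePoint_pair {i : Fin 3} {t t' : F} (h : t ≠ t') {w : Fin 3 → F}
    (hw : w i = 0) : w ∈ Submodule.span F {sidePoint a i t, sidePoint a i t'} := by
  have hne : ∀ i j, i ≠ j → a i - a j ≠ 0 := fun i j h => sub_ne_zero.2 fun h' => h (ha h')
  -- `D` is the determinant of the two points in the coordinates `i + 1` and `i + 2`; `key` is
  -- Cramer's rule without division.
  set D := (a (i + 2) - a i) * (a i - a (i + 1)) * (t - t') * (a (i + 1) - a (i + 2)) with hD
  have hD0 : D ≠ 0 := by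
    refine mul_ne_zero (mul_ne_zero (mul_ne_zero ?_ ?_) (sub_ne_zero.2 h)) ?_ <;>
      exact hne _ _ (by omega)
  have key : D • w = (-lineCoeff a t' (i + 1) * w (i + 1) - lineCoeff a t' (i + 2) * w (i + 2)) •
      sidePoint a i t + (lineCoeff a t (i + 2) * w (i + 2) + lineCoeff a t (i + 1) * w (i + 1)) •
      sidePoint a i t' := by
    fin_cases i <;> ext l <;> fin_cases l <;> simp at hw <;>
      simp [sidePoint, lineCoeff, hD, hw] <;> ring
  rw [← Submodule.smul_mem_iff _ hD0, key]
  exact Submodule.mem_span_pair.2 ⟨_, _, rfl⟩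

/-- The three coefficients of a line through the all-one point sum to zero, so the difference of two
side points of one color is a constant vector. -/
theorem one_mem_span_sidePoint {i j k : Fin 3} (hij : i ≠ j) (hjk : j ≠ k) (hik : i ≠ k) {t : F}
    (h : t ≠ a k) : (1 : Fin 3 → F) ∈ Submodule.span F {sidePoint a i t, sidePoint a j t} := by
  have h0 := lineCoeff_ne_zero ha h
  rw [← Submodule.smul_mem_iff _ h0]
  have key : lineCoeff a t k • (1 : Fin 3 → F) = sidePoint a i t - sidePoint a j t ∨
      lineCoeff a t k • (1 : Fin 3 → F) = sidePoint a j t - sidePoint a i t := by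
    have : j = i + 1 ∧ k = i + 2 ∨ j = i + 2 ∧ k = i + 1 := by omega
    rcases this with ⟨rfl, rfl⟩ | ⟨rfl, rfl⟩
    · left
      fin_cases i <;> ext l <;> fin_cases l <;> simp [sidePoint, lineCoeff] <;> ring
    · right
      fin_cases i <;> ext l <;> fin_cases l <;> simp [sidePoint, lineCoeff] <;> ring
  rcases key with h | h <;> rw [h]
  · exact sub_mem (Submodule.subset_span (by simp)) (Submodule.subset_span (by simp))
  · exact sub_mem (Submodule.subset_span (by simp)) (Submodule.subset_span (by simp))

theorem sidePoint_apply_ne_zero {i j k : Fin 3} (hij : i ≠ j) (hjk : j ≠ k) (hik : i ≠ k) {t : F}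
    (h : t ≠ a k) : sidePoint a j t i ≠ 0 := by
  have h0 := lineCoeff_ne_zero ha h
  have : j = i + 1 ∧ k = i + 2 ∨ j = i + 2 ∧ k = i + 1 := by omega
  rcases this with ⟨rfl, rfl⟩ | ⟨rfl, rfl⟩
  · fin_cases i <;> simpa [sidePoint] using h0
  · fin_cases i <;> simpa [sidePoint] using h0

theorem one_mem_span_sidePoint_triple {i j k : Fin 3} (hij : i ≠ j) (hjk : j ≠ k) (hik : i ≠ k)
    {t t' u : F} (h : t ≠ t') (hu : u ≠ a k) :
    (1 : Fin 3 → F) ∈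
      Submodule.span F {sidePoint a i t, sidePoint a i t', sidePoint a j u} := by
  have h0 := sidePoint_apply_ne_zero ha hij hjk hik hu
  set v := sidePoint a j u
  have h1 : (1 : Fin 3 → F) - (v i)⁻¹ • v ∈
      Submodule.span F {sidePoint a i t, sidePoint a i t'} :=
    mem_span_sidePoint_pair ha h (by simp [h0])
  rw [← sub_add_cancel (1 : Fin 3 → F) ((v i)⁻¹ • v)]
  refine add_mem (Submodule.span_mono ?_ h1) (Submodule.smul_mem _ _ (Submodule.subset_span ?_))
  · intro x hx
    simp only [Set.mem_insert_iff, Set.mem_singleton_iff] at hx ⊢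
    tauto
  · simp

omit ha in
theorem sidePoint_src (a : Fin 3 → F) {i j : Fin 3} (hij : j ≠ i) :
    sidePoint a i (a j) ∈ Submodule.span F {(Pi.single j 1 : Fin 3 → F)} := by
  rw [Submodule.mem_span_singleton]
  have : j = i + 1 ∨ j = i + 2 := by omega
  rcases this with rfl | rfl
  · refine ⟨lineCoeff a (a (i + 1)) (i + 2), ?_⟩
    fin_cases i <;> ext l <;> fin_cases l <;> simp [sidePoint, lineCoeff]
  · refine ⟨-lineCoeff a (a (i + 2)) (i + 1), ?_⟩
    fin_cases i <;> ext l <;> fin_cases l <;> simp [sidePoint, lineCoeff]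

end Vectors

/-! ### From colorings to vectors on the boundary. -/

section Code

variable {F : Type*} [Field F] {e : Color α → F} (he : Function.Injective e)

variable (Y) in
/-- The vectors realizing a coloring of the boundary. -/
noncomputable def boundaryCode (e : Color α → F) (c : α → Color α) (x : α) : Fin 3 → F :=
  open Classical in
  if h : ∃ i, x = Y.src i then Pi.single h.choose 1
  else if h : ∃ i, x ∈ Y.int i then sidePoint (fun i => e (corner i)) h.choose (e (c x)) else 0

theorem boundaryCode_src (e : Color α → F) (c : α → Color α) (i : Fin 3) :
    Y.boundaryCode e c (Y.src i) = Pi.single i 1 := by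
  have h : ∃ j, Y.src i = Y.src j := ⟨i, rfl⟩
  rw [boundaryCode, dif_pos h, ← Y.src_injective h.choose_spec]

theorem boundaryCode_int (e : Color α → F) (c : α → Color α) {i : Fin 3} {x : α}
    (hx : x ∈ Y.int i) :
    Y.boundaryCode e c x = sidePoint (fun i => e (corner i)) i (e (c x)) := by
  have h : ∃ i, x ∈ Y.int i := ⟨i, hx⟩
  rw [boundaryCode, dif_neg (fun ⟨j, e⟩ => hx.2 j e), dif_pos h, eq_of_mem_int h.choose_spec hx]

theorem sidePoint_mem_span {c : α → Color α} (hc : ∀ i, c (Y.src i) = corner i) {i : Fin 3} {x : α}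
    (hx : x ∈ Y.side i) : sidePoint (fun i => e (corner i)) i (e (c x)) ∈
      Submodule.span F {Y.boundaryCode e c x} := by
  rcases mem_side_cases hx with ⟨j, hj, rfl⟩ | hx
  · rw [boundaryCode_src, hc]
    exact sidePoint_src (fun i => e (corner i)) hj
  · rw [boundaryCode_int e c hx]
    exact Submodule.mem_span_singleton_self _

theorem sidePoint_mem_span_image {c : α → Color α} (hc : ∀ i, c (Y.src i) = corner i) {i : Fin 3}
    {x : α} (hx : x ∈ Y.side i) {A : Set α} (hA : x ∈ A) :
    sidePoint (fun i => e (corner i)) i (e (c x)) ∈ Submodule.span F (Y.boundaryCode e c '' A) :=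
  Submodule.span_mono (by rintro _ rfl; exact ⟨x, hA, rfl⟩) (sidePoint_mem_span hc hx)

include he

theorem boundaryCode_mem_span {c : α → Color α} (hc : Y.IsColoring c) {i : Fin 3} {x : α}
    (hx : x ∈ Y.int i) :
    Y.boundaryCode e c x ∈ Submodule.span F (Y.boundaryCode e c '' Y.par x) := by
  have ha : Function.Injective fun i => e (corner i) := fun i j h => corner.inj (he h)
  rw [boundaryCode_int e c hx]
  obtain ⟨p, hp⟩ := (Y.nontrivial x (mem_inner_of_mem_int hx)).nonempty
  have hsub := par_subset_side hx
  by_cases h : ∃ q ∈ Y.par x, c q ≠ c p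
  · obtain ⟨q, hq, hne⟩ := h
    refine Submodule.span_le.2 ?_ (mem_span_sidePoint_pair ha (he.ne hne)
      (sidePoint_apply_self _ i (e (c x))))
    rintro _ (rfl | rfl)
    · exact sidePoint_mem_span_image hc.src (hsub hq) hq
    · exact sidePoint_mem_span_image hc.src (hsub hp) hp
  · push Not at h
    rw [hc.int i x hx _ h]
    exact sidePoint_mem_span_image hc.src (hsub hp) hp

theorem Good.one_mem_span {c : α → Color α} (hc : Y.IsColoring c) {L : Set α} (h : Y.Good c L) :
    (1 : Fin 3 → F) ∈ Submodule.span F (Y.boundaryCode e c '' L) := by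
  have ha : Function.Injective fun i => e (corner i) := fun i j h => corner.inj (he h)
  rcases h with ⟨i, j, k, hij, hjk, hik, x, hx, y, hy, hxi, hyj, h, h'⟩ |
    ⟨i, j, k, hij, hjk, hik, x, hx, y, hy, z, hz, hxi, hyi, hzj, h, h'⟩
  · refine Submodule.span_le.2 ?_ (one_mem_span_sidePoint ha hij hjk hik (he.ne h'))
    rintro _ (rfl | rfl)
    · exact sidePoint_mem_span_image hc.src hxi hx
    · rw [h]
      exact sidePoint_mem_span_image hc.src hyj hy
  · refine Submodule.span_le.2 ?_ (one_mem_span_sidePoint_triple ha hij hjk hik (he.ne h)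
      (he.ne h'))
    rintro _ (rfl | rfl | rfl)
    · exact sidePoint_mem_span_image hc.src hxi hx
    · exact sidePoint_mem_span_image hc.src hyi hy
    · exact sidePoint_mem_span_image hc.src hzj hz

end Code

theorem exists_finite_field_embedding (β : Type*) [Finite β] :
    ∃ (F : Type) (_ : Field F) (_ : Finite F) (e : β → F), Function.Injective e := by
  obtain ⟨n, ⟨f⟩⟩ := Finite.exists_equiv_fin β
  obtain ⟨p, hnp, hp⟩ := Nat.exists_infinite_primes n
  have := Fact.mk hp
  refine ⟨ZMod p, inferInstance, inferInstance, fun b => ((f b : ℕ) : ZMod p), fun b b' h => ?_⟩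
  have := (ZMod.natCast_eq_natCast_iff' _ _ _).1 h
  rw [Nat.mod_eq_of_lt ((f b).2.trans_le hnp), Nat.mod_eq_of_lt ((f b').2.trans_le hnp)] at this
  exact f.injective (Fin.ext this)

instance [Finite α] : Finite (Color α) :=
  Finite.of_surjective (fun x : Fin 3 ⊕ Unit ⊕ α => match x with
    | .inl i => corner i
    | .inr (.inl _) => generic
    | .inr (.inr a) => own a) fun x => by
    cases x with
    | corner i => exact ⟨.inl i, rfl⟩
    | generic => exact ⟨.inr (.inl ()), rfl⟩
    | own a => exact ⟨.inr (.inr a), rfl⟩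

/-! ### Ancestors and frontiers. -/

variable (Y) in
/-- There is a directed path, possibly of length zero. -/
def Path (x y : α) : Prop := Relation.ReflTransGen (fun a b => a ∈ Y.par b) x y

variable (Y) in
/-- The vertices outside the boundary from which `x` can be reached. -/
def ancestors (x : α) : Set α := {y | y ∉ Y.boundary ∧ Y.Path y x}

variable (Y) in
/-- The boundary vertices with a child among the ancestors of `x`. -/
def frontier (x : α) : Set α := {q | q ∈ Y.boundary ∧ ∃ y ∈ Y.ancestors x, q ∈ Y.par y}

theorem path_antisymm {x y : α} (h : Y.Path x y) (h' : Y.Path y x) : x = y := by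
  rcases Relation.reflTransGen_iff_eq_or_transGen.1 h with e | h1
  · exact e.symm
  · have := Relation.TransGen.trans_left h1 h'
    exact absurd this ((Y.wf.transGen).irrefl.irrefl x)

theorem mem_inner_of_path {x y : α} (hx : x ∈ Y.inner) (hy : y ∉ Y.boundary) (h : Y.Path y x) :
    y ∈ Y.inner := by
  rcases Relation.ReflTransGen.cases_head h with rfl | ⟨z, hyz, -⟩
  · exact hx
  · rcases Y.mem_of_par hyz with h | ⟨i, rfl⟩
    · exact h
    · exact absurd (src_mem_boundary i) hy

theorem frontier_subset_boundary (x : α) : Y.frontier x ⊆ Y.boundary := fun _ h => h.1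

theorem par_mem_ancestors {x y a : α} (hy : y ∈ Y.ancestors x) (ha : a ∈ Y.par y)
    (ha' : a ∉ Y.boundary) : a ∈ Y.ancestors x :=
  ⟨ha', .head ha hy.2⟩

/-- Otherwise the super region `side i` would absorb all ancestors, including `x` itself. -/
theorem frontier_not_subset_side {x : α} (hx : x ∈ Y.inner) (hx' : x ∉ Y.boundary) (i : Fin 3) :
    ¬ Y.frontier x ⊆ Y.side i := by
  intro h
  have key : ∀ y, y ∈ Y.ancestors x → y ∈ Y.side i := by
    intro y
    induction y using Y.wf.induction with
    | _ y ih =>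
      intro hy
      refine InClosure.step (mem_inner_of_path hx hy.1 hy.2) fun a ha => ?_
      by_cases hab : a ∈ Y.boundary
      · exact h ⟨hab, y, hy, ha⟩
      · exact ih a ha (par_mem_ancestors hy ha hab)
  exact hx' ⟨i, key x ⟨hx', .refl⟩⟩

section Flow

variable {F V : Type*} [Field F] [AddCommGroup V] [Module F V]

-- Every frontier vertex (suitably scaled) and every ancestor other than `x` hands its vector to a
-- single chosen child `next z`. Nothing is duplicated or lost, so everything arrives at `x`.
open Classical in
theorem exists_flow [Finite α] (d : α → V) {x : α} (hx : x ∉ Y.boundary) {v : V}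
    (hv : v ∈ Submodule.span F (d '' Y.frontier x)) :
    ∃ g : α → V, g x = v ∧ ∀ y ∈ Y.ancestors x,
      g y ∈ Submodule.span F ((fun a => if a ∈ Y.boundary then d a else g a) '' Y.par y) := by
  have := Fintype.ofFinite α
  obtain ⟨l, hl, rfl⟩ := (Finsupp.mem_span_image_iff_linearCombination F).1 hv
  have hxA : x ∈ Y.ancestors x := ⟨hx, .refl⟩
  set M : Set α := Y.ancestors x \ {x} ∪ Y.frontier x with hM
  have hnext : ∀ z, ∃ y, z ∈ M → y ∈ Y.ancestors x ∧ z ∈ Y.par y := by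
    intro z
    by_cases hz : z ∈ M
    · rcases hz with ⟨hz, hzx⟩ | ⟨_, y, hy, hzy⟩
      · rcases Relation.ReflTransGen.cases_head hz.2 with rfl | ⟨y, hzy, hyx⟩
        · exact absurd rfl hzx
        · refine ⟨y, fun _ => ⟨⟨fun hyb => hz.1 ?_, hyx⟩, hzy⟩⟩
          rcases mem_boundary_cases hyb with ⟨i, rfl⟩ | ⟨i, hi⟩
          · exact absurd hzy (by simp [Y.par_src])
          · exact ⟨i, par_subset_side hi hzy⟩
      · exact ⟨y, fun _ => ⟨hy, hzy⟩⟩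
    · exact ⟨z, fun h => absurd h hz⟩
  choose next hnext using hnext
  let A : Finset α := {y | y ∈ Y.ancestors x}
  let B : Finset α := {z | z ∈ Y.frontier x}
  have hAB : Disjoint (A.erase x) B := Finset.disjoint_left.2 fun z hz hz' => by
    simp only [A, B, Finset.mem_erase, Finset.mem_filter, Finset.mem_univ, true_and] at hz hz'
    exact hz.2.1 hz'.1
  have hmemM : ∀ z, z ∈ A.erase x ∪ B → z ∈ M := fun z hz => by
    simp only [A, B, Finset.mem_union, Finset.mem_erase, Finset.mem_filter, Finset.mem_univ,
      true_and] at hz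
    exact hz.imp And.symm id
  -- On the index set, `next z = y` entails `z ∈ par y`; the test only licenses the recursive call,
  -- and its default `0` is never used.
  let step : (y : α) → ((z : α) → z ∈ Y.par y → V) → V := fun y rec =>
    ∑ z ∈ A.erase x ∪ B with next z = y, if hz : z ∈ Y.par y then
      (if z ∈ Y.boundary then l z • d z else rec z hz) else 0
  let g : α → V := Y.wf.fix step
  let h : α → V := fun z => if z ∈ Y.boundary then l z • d z else g z
  have hg : ∀ y, g y = ∑ z ∈ A.erase x ∪ B with next z = y, h z := by
    intro y
    refine (Y.wf.fix_eq step y).trans (Finset.sum_congr rfl fun z hz => ?_)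
    obtain ⟨hzM, rfl⟩ := Finset.mem_filter.1 hz
    exact dif_pos (hnext z (hmemM z hzM)).2
  refine ⟨g, ?_, fun y hy => ?_⟩
  -- Summing over all ancestors counts each `h z` once, under its `next z`. Cancelling the ancestors
  -- other than `x` leaves `g x`.
  · have h1 : ∑ y ∈ A, g y = ∑ z ∈ A.erase x ∪ B, h z := by
      rw [Finset.sum_congr rfl fun y _ => hg y]
      refine Finset.sum_fiberwise_of_maps_to (fun z hz => ?_) h
      simpa [A] using (hnext z (hmemM z hz)).1
    have h2 : ∑ z ∈ A.erase x, h z = ∑ z ∈ A.erase x, g z := Finset.sum_congr rfl fun z hz =>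
      if_neg (Finset.mem_filter.1 (Finset.mem_of_mem_erase hz)).2.1
    have h3 : ∑ z ∈ B, h z = Finsupp.linearCombination F d l := by
      rw [Finsupp.linearCombination_apply, Finsupp.sum_of_support_subset (s := B)]
      · exact Finset.sum_congr rfl fun z hz => if_pos (Finset.mem_filter.1 hz).2.1
      · intro z hz
        simpa [B] using hl hz
      · simp
    rw [Finset.sum_union hAB, h2, h3, ← Finset.add_sum_erase A g (by simpa [A] using hxA),
      add_comm] at h1
    exact add_left_cancel h1
  · rw [hg]
    refine Submodule.sum_mem _ fun z hz => ?_
    obtain ⟨hzM', rfl⟩ := Finset.mem_filter.1 hz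
    have hzM := hmemM z hzM'
    by_cases hzb : z ∈ Y.boundary
    · simp only [h, if_pos hzb]
      exact Submodule.smul_mem _ _ (Submodule.subset_span ⟨z, (hnext z hzM).2, if_pos hzb⟩)
    · simp only [h, if_neg hzb]
      exact Submodule.subset_span ⟨z, (hnext z hzM).2, if_neg hzb⟩

end Flow
-- Codes on the whole region system.
variable (Y) in
/-- A linear code on the region system. -/
structure IsCode {F : Type*} [Field F] (d : α → Fin 3 → F) : Prop where
  src : ∀ i, d (Y.src i) = Pi.single i 1
  inner : ∀ x ∈ Y.inner, d x ∈ Submodule.span F (d '' Y.par x)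

variable (Y) in
/-- Over some finite field there is a linear code that carries the all-one vector at every
`T t`. -/
def HasCode (T : Fin 3 → α) : Prop :=
  ∃ (F : Type) (_ : Field F) (_ : Finite F) (d : α → Fin 3 → F), Y.IsCode d ∧ ∀ t, d (T t) = 1

theorem notMem_boundary_of_path {x y : α} (hx : x ∉ Y.boundary) (h : Y.Path x y) :
    y ∉ Y.boundary := by
  induction h with
  | refl => exact hx
  | tail _ hbc ih =>
    intro hc
    rcases mem_boundary_cases hc with ⟨i, rfl⟩ | ⟨i, hi⟩
    · simp [Y.par_src] at hbc
    · exact ih ⟨i, par_subset_side hi hbc⟩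

/-- The all-one vector obtained at `X t` is passed on unchanged to everything below, in particular
to `T t`. Remaining vertices outside the boundary carry zero. -/
theorem hasCode_of_targets [Finite α] {X T : Fin 3 → α} (hXb : ∀ t, X t ∉ Y.boundary)
    (hXT : ∀ t, Y.Path (X t) (T t))
    (hdisj : ∀ t u, X t = X u ∨ Disjoint (Y.ancestors (X t)) (Y.ancestors (X u)))
    (hgood : Y.HasGoodColoring fun t => Y.frontier (X t)) : Y.HasCode T := by
  classical
  obtain ⟨c, hc, hg⟩ := hgood
  obtain ⟨F, hF, hfin, e, he⟩ := exists_finite_field_embedding (Color α)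
  refine ⟨F, hF, hfin, ?_⟩
  have hflow : ∀ x, ∃ g : α → Fin 3 → F, (∃ t, x = X t) → g x = 1 ∧ ∀ y ∈ Y.ancestors x,
      g y ∈ Submodule.span F
        ((fun a => if a ∈ Y.boundary then Y.boundaryCode e c a else g a) '' Y.par y) := by
    intro x
    by_cases hx : ∃ t, x = X t
    · obtain ⟨t, rfl⟩ := hx
      obtain ⟨g, h⟩ := exists_flow _ (hXb t) ((hg t).one_mem_span he hc)
      exact ⟨g, fun _ => h⟩
    · exact ⟨fun _ => 0, fun h => absurd h hx⟩
  choose g hg1 hg2 using fun x => (hflow x)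
  have hself : ∀ t, X t ∈ Y.ancestors (X t) := fun t => ⟨hXb t, .refl⟩
  have heq : ∀ t u y, y ∈ Y.ancestors (X t) → y ∈ Y.ancestors (X u) → X t = X u :=
    fun t u y ht hu => (hdisj t u).resolve_right fun h => Set.disjoint_left.1 h ht hu
  let d : α → Fin 3 → F := fun y =>
    if y ∈ Y.boundary then Y.boundaryCode e c y
    else if h : ∃ t, y ∈ Y.ancestors (X t) then g (X h.choose) y
    else if ∃ t, Y.Path (X t) y then 1 else 0
  have hd1 : ∀ y ∈ Y.boundary, d y = Y.boundaryCode e c y := fun y hy => if_pos hy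
  have hd2 : ∀ t, ∀ y ∈ Y.ancestors (X t), d y = g (X t) y := by
    intro t y hy
    have h : ∃ t, y ∈ Y.ancestors (X t) := ⟨t, hy⟩
    simp only [d]
    rw [if_neg hy.1, dif_pos h, heq _ _ y h.choose_spec hy]
  have hd3 : ∀ t y, Y.Path (X t) y → d y = 1 := by
    intro t y hty
    by_cases h : ∃ u, y ∈ Y.ancestors (X u)
    · obtain ⟨u, hu⟩ := h
      -- A vertex below `X t` and above `X u` is `X t` itself by acyclicity, so the two rules for
      -- `d` agree.
      have htu : X t = X u := heq t u (X t) (hself t) ⟨hXb t, hty.trans hu.2⟩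
      have hy : X t = y := path_antisymm hty (htu ▸ hu.2)
      rw [← hy, hd2 t _ (hself t), hg1 _ ⟨t, rfl⟩]
    · simp only [d]
      rw [if_neg (notMem_boundary_of_path (hXb t) hty), dif_neg h, if_pos ⟨t, hty⟩]
  refine ⟨d, ⟨fun i => ?_, fun x hx => ?_⟩, fun t => hd3 t _ (hXT t)⟩
  · rw [hd1 _ (src_mem_boundary i), boundaryCode_src]
  · by_cases hxb : x ∈ Y.boundary
    · rcases mem_boundary_cases hxb with ⟨i, rfl⟩ | ⟨i, hi⟩
      · exact absurd hx (Y.src_notMem i)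
      · rw [hd1 x hxb, Set.image_congr fun a ha => hd1 a ⟨i, par_subset_side hi ha⟩]
        exact boundaryCode_mem_span he hc hi
    by_cases h : ∃ t, x ∈ Y.ancestors (X t)
    · obtain ⟨t, ht⟩ := h
      rw [hd2 t x ht]
      convert hg2 _ ⟨t, rfl⟩ x ht using 2
      refine Set.image_congr fun a ha => ?_
      split_ifs with hab
      · exact hd1 a hab
      · exact hd2 t a (par_mem_ancestors ht ha hab)
    by_cases h' : ∃ t, Y.Path (X t) x
    · obtain ⟨t, ht⟩ := h'
      rw [hd3 t x ht]
      rcases Relation.ReflTransGen.cases_tail ht with e' | ⟨a, hta, ha⟩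
      · exact absurd ⟨t, e' ▸ hself t⟩ h
      · exact Submodule.subset_span ⟨a, ha, hd3 t a hta⟩
    · have : d x = 0 := by
        simp only [d]
        rw [if_neg hxb, dif_neg h, if_neg h']
      rw [this]
      exact Submodule.zero_mem _

variable (Y) in
/-- No vertex outside the boundary is connected to two terminals. -/
def Separable (T : Fin 3 → α) : Prop :=
  ∀ x ∉ Y.boundary, ∀ t u, Y.Path x (T t) → Y.Path x (T u) → t = u

theorem hasCode_or_exceptional [Finite α] {T : Fin 3 → α} (hTi : ∀ t, T t ∈ Y.inner)
    (hTb : ∀ t, T t ∉ Y.boundary) :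
    Y.HasCode T ∨ Y.Separable T ∧ Y.Exceptional fun t => Y.frontier (T t) := by
  classical
  by_cases hsep : Y.Separable T
  · rcases hasGoodColoring_or_exceptional (L := fun t => Y.frontier (T t))
      (fun t => frontier_subset_boundary _)
      (fun t i => frontier_not_subset_side (hTi t) (hTb t) i) with h | h
    · refine .inl (hasCode_of_targets hTb (fun t => .refl) (fun t u => ?_) h)
      by_cases htu : t = u
      · exact .inl (by rw [htu])
      · exact .inr (Set.disjoint_left.2 fun y hy hy' => htu (hsep y hy.1 t u hy.2 hy'.2))
    · exact .inr ⟨hsep, h⟩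
  left
  -- `r` reaches all terminals if some vertex does. Otherwise an ancestor of `r` reaching a third
  -- terminal would reach all three, so terminals not below `r` share no ancestors with it.
  have hR : ∃ r ∉ Y.boundary, ∃ t u, t ≠ u ∧ Y.Path r (T t) ∧ Y.Path r (T u) ∧
      ∀ s, ¬ Y.Path r (T s) → ∀ y ∈ Y.ancestors r, ¬ Y.Path y (T s) := by
    by_cases hall : ∃ r ∉ Y.boundary, ∀ t, Y.Path r (T t)
    · obtain ⟨r, hr, h⟩ := hall
      exact ⟨r, hr, 0, 1, by decide, h 0, h 1, fun s hs => absurd (h s) hs⟩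
    · unfold Separable at hsep
      push Not at hsep hall
      obtain ⟨r, hr, t, u, ht, hu, htu⟩ := hsep
      refine ⟨r, hr, t, u, htu, ht, hu, fun s hs y hy hys => ?_⟩
      obtain ⟨l, hl⟩ := hall y hy.1
      have hst : s ≠ t := fun h => hs (h ▸ ht)
      have hsu : s ≠ u := fun h => hs (h ▸ hu)
      exact hl (forall_fin_three (p := fun l => Y.Path y (T l)) htu hsu.symm hst.symm
        (hy.2.trans ht) (hy.2.trans hu) hys l)
  obtain ⟨r, hr, t, u, htu, hrt, hru, hdis⟩ := hR
  set X : Fin 3 → α := fun s => if Y.Path r (T s) then r else T s with hX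
  have hX1 : ∀ s, Y.Path r (T s) → X s = r := fun s hs => if_pos hs
  have hX2 : ∀ s, ¬ Y.Path r (T s) → X s = T s := fun s hs => if_neg hs
  have hXi : ∀ s, X s ∈ Y.inner := fun s => by
    by_cases hs : Y.Path r (T s)
    · rw [hX1 s hs]
      exact mem_inner_of_path (hTi t) hr hrt
    · rw [hX2 s hs]
      exact hTi s
  have hXb : ∀ s, X s ∉ Y.boundary := fun s => by
    by_cases hs : Y.Path r (T s)
    · rwa [hX1 s hs]
    · rw [hX2 s hs]
      exact hTb s
  rcases hasGoodColoring_or_exceptional (L := fun t => Y.frontier (X t))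
    (fun t => frontier_subset_boundary _)
    (fun t i => frontier_not_subset_side (hXi t) (hXb t) i) with h | h
  · refine hasCode_of_targets hXb (fun s => ?_) (fun s s' => ?_) h
    · by_cases hs : Y.Path r (T s)
      · rwa [hX1 s hs]
      · rw [hX2 s hs]
        exact .refl
    · by_cases hs : Y.Path r (T s) <;> by_cases hs' : Y.Path r (T s')
      · rw [hX1 s hs, hX1 s' hs']
        exact .inl rfl
      · rw [hX1 s hs, hX2 s' hs']
        exact .inr (Set.disjoint_left.2 fun y hy hy' => hdis s' hs' y hy hy'.2)
      · rw [hX1 s' hs', hX2 s hs]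
        exact .inr (Set.disjoint_left.2 fun y hy hy' => hdis s hs y hy' hy.2)
      · have h1 : s ≠ t := fun h => hs (h ▸ hrt)
        have h2 : s ≠ u := fun h => hs (h ▸ hru)
        have h3 : s' ≠ t := fun h => hs' (h ▸ hrt)
        have h4 : s' ≠ u := fun h => hs' (h ▸ hru)
        have : s = s' := by omega
        exact .inl (by rw [this])
  · refine absurd (h.injective ?_) htu
    simp only [hX1 t hrt, hX1 u hru]

/-! ### Infeasibility of the exceptional configuration -/

section Infeasible

variable {F : Type*} [Field F] {d : α → Fin 3 → F}

theorem apply_eq_zero_of_mem_span {A : Set α} {i : Fin 3} (h : ∀ a ∈ A, d a i = 0)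
    {v : Fin 3 → F} (hv : v ∈ Submodule.span F (d '' A)) : v i = 0 := by
  have : Submodule.span F (d '' A) ≤ LinearMap.ker (LinearMap.proj (R := F) (φ := fun _ => F) i) :=
    Submodule.span_le.2 (by rintro _ ⟨a, ha, rfl⟩; exact h a ha)
  exact this hv

theorem IsCode.apply_eq_zero_of_mem_closure (hd : Y.IsCode d) {Θ : Set α} {i : Fin 3}
    (h : ∀ a ∈ Θ, d a i = 0) {x : α} (hx : x ∈ Y.closure Θ) : d x i = 0 := by
  induction hx with
  | base hx => exact h _ hx
  | step hx _ ih => exact apply_eq_zero_of_mem_span ih (hd.inner _ hx)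

theorem IsCode.apply_eq_zero_of_mem_side (hd : Y.IsCode d) {i : Fin 3} {x : α}
    (hx : x ∈ Y.side i) : d x i = 0 := by
  refine hd.apply_eq_zero_of_mem_closure ?_ hx
  rintro _ ⟨j, hj, rfl⟩
  rw [hd.src]
  exact Pi.single_eq_of_ne (Ne.symm hj) 1

theorem IsCode.mem_span_frontier (hd : Y.IsCode d) {x y : α} (hx : x ∈ Y.inner)
    (hy : y ∈ Y.ancestors x) : d y ∈ Submodule.span F (d '' Y.frontier x) := by
  induction y using Y.wf.induction with
  | _ y ih =>
    refine Submodule.span_le.2 ?_ (hd.inner y (mem_inner_of_path hx hy.1 hy.2))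
    rintro _ ⟨a, ha, rfl⟩
    by_cases hab : a ∈ Y.boundary
    · exact Submodule.subset_span ⟨a, ⟨hab, y, hy, ha⟩, rfl⟩
    · exact ih a ha (par_mem_ancestors hy ha hab)

theorem IsCode.not_exceptional (hd : Y.IsCode d) {L : Fin 3 → Set α}
    (hL : ∀ t, (1 : Fin 3 → F) ∈ Submodule.span F (d '' L t)) : ¬ Y.Exceptional L := by
  rintro ⟨i, j, k, hij, hjk, hik, t, u, w, htu, huw, htw, p, hp, q, hq, ht, hu, hw⟩
  have h1 := hL t
  have h2 := hL u
  rw [ht, Set.image_pair, Submodule.mem_span_pair] at h1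
  rw [hu, Set.image_pair, Submodule.mem_span_pair] at h2
  obtain ⟨a, b, h1⟩ := h1
  obtain ⟨a', b', h2⟩ := h2
  have hpi := hd.apply_eq_zero_of_mem_side hp.1
  have hqk := hd.apply_eq_zero_of_mem_side hq.1
  have e1 := congrFun h1 j
  have e2 := congrFun h1 k
  have e3 := congrFun h2 i
  have e4 := congrFun h2 j
  have e5 := congrFun h2 k
  simp only [hd.src, Pi.add_apply, Pi.smul_apply, smul_eq_mul, Pi.one_apply, hpi, hqk,
    Pi.single_eq_of_ne hij.symm, Pi.single_eq_of_ne hik.symm, mul_zero, zero_add, add_zero]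
    at e1 e2 e3 e4 e5
  have hpk : d p k ≠ 0 := fun h => by simp [h] at e2
  have hb' : b' ≠ 0 := fun h => by simp [h] at e3
  -- `p` has equal coordinates at `j` and `k`, and `q` vanishes at `k`. The multiple of `p` that
  -- settles coordinate `k` also settles `j`, which leaves nothing there for `q`.
  have hab : a' = b := mul_right_cancel₀ hpk (e5.trans e2.symm)
  have hqj : d q j = 0 := by
    rw [hab, e1] at e4
    exact (mul_eq_zero.1 (left_eq_add.1 e4.symm)).resolve_left hb'
  have := apply_eq_zero_of_mem_span (i := j) (fun x hx => ?_) (hL w)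
  · exact one_ne_zero this
  · rcases hw hx with h | h
    · refine hd.apply_eq_zero_of_mem_closure ?_ h
      rintro _ (rfl | rfl)
      · rw [hd.src]
        exact Pi.single_eq_of_ne hij.symm 1
      · exact hqj
    · exact hd.apply_eq_zero_of_mem_side h

end Infeasible

theorem not_hasCode_iff [Finite α] {T : Fin 3 → α} (hTi : ∀ t, T t ∈ Y.inner)
    (hTb : ∀ t, T t ∉ Y.boundary) :
    ¬ Y.HasCode T ↔ Y.Separable T ∧ Y.Exceptional fun t => Y.frontier (T t) := by
  refine ⟨(hasCode_or_exceptional hTi hTb).resolve_left, ?_⟩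
  rintro ⟨-, hex⟩ ⟨F, hF, hfin, d, hd, hT⟩
  refine hd.not_exceptional (fun t => ?_) hex
  rw [← hT t]
  exact hd.mem_span_frontier (hTi t) ⟨hTb t, .refl⟩

end RegionSystem

namespace SumNetwork

instance {E : Type*} [Finite E] {k n : ℕ} : Finite (Link E k n) :=
  Finite.of_surjective (fun x : E ⊕ Fin k ⊕ Fin n => match x with
    | .inl e => Link.ordinary e
    | .inr (.inl i) => .source i
    | .inr (.inr j) => .terminal j) fun x => by
    cases x with
    | ordinary e => exact ⟨.inl e, rfl⟩
    | source i => exact ⟨.inr (.inl i), rfl⟩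
    | terminal j => exact ⟨.inr (.inr j), rfl⟩

/-! ### Leaders and acyclicity of the region graph. -/

section Leaders

variable {V E : Type*} {k n : ℕ} {G : SumNetwork V E k n}

theorem inLinks_source (i : Fin k) : G.inLinks (.source i) = ∅ := by
  ext e
  simp [inLinks, tail?]

/-- Intermediate links of a chain have both a tail and a head, hence are ordinary, so the chain
projects to a walk between nodes. -/
theorem exists_path_of_transGen {e e' : Link E k n}
    (h : Relation.TransGen (fun a b => a ∈ G.inLinks b) e e') :
    ∃ u v, G.head? e = some u ∧ G.tail? e' = some v ∧
      Relation.ReflTransGen (fun u w => ∃ e, G.tail e = u ∧ G.head e = w) u v := by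
  induction h with
  | single h =>
    obtain ⟨v, h1, h2⟩ := h
    exact ⟨v, v, h1, h2, .refl⟩
  | @tail b c _ h ih =>
    obtain ⟨u, v, h1, h2, h3⟩ := ih
    obtain ⟨w, h4, h5⟩ := h
    refine ⟨u, w, h1, h5, ?_⟩
    cases b with
    | ordinary e =>
      simp only [tail?, head?, Option.some.injEq] at h2 h4
      exact h3.tail ⟨e, h2, h4⟩
    | source i => simp [tail?] at h2
    | terminal j => simp [head?] at h4

theorem not_transGen_inLinks (e : Link E k n) :
    ¬ Relation.TransGen (fun a b => a ∈ G.inLinks b) e e := by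
  intro h
  obtain ⟨u, v, h1, h2, h3⟩ := exists_path_of_transGen h
  cases e with
  | ordinary e =>
    simp only [tail?, head?, Option.some.injEq] at h1 h2
    exact G.acyclic v (.head' ⟨e, h2, h1⟩ h3)
  | source i => simp [tail?] at h2
  | terminal j => simp [head?] at h1

variable (G) in
theorem wellFounded_inLinks [Finite E] :
    WellFounded (Relation.TransGen fun a b => a ∈ G.inLinks b) := by
  have : Std.Irrefl (Relation.TransGen fun a b : Link E k n => a ∈ G.inLinks b) :=
    ⟨not_transGen_inLinks⟩
  exact Finite.wellFounded_of_trans_of_irrefl _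

theorem IsLeader.reflTransGen [Finite E] {R : Set (Link E k n)} {l e : Link E k n}
    (hl : G.IsLeader R l) (he : e ∈ R) :
    Relation.ReflTransGen (fun a b => a ∈ G.inLinks b) l e := by
  induction e using (G.wellFounded_inLinks).induction with
  | _ e ih =>
    by_cases h : e = l
    · rw [h]
    · obtain ⟨e', h1, h2⟩ := hl.2 e he h
      exact (ih e' (.single h1) h2).tail h1

theorem IsLeader.unique [Finite E] {R : Set (Link E k n)} {l l' : Link E k n}
    (hl : G.IsLeader R l) (hl' : G.IsLeader R l') : l = l' := by
  rcases Relation.reflTransGen_iff_eq_or_transGen.1 (hl.reflTransGen hl'.1) with h | h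
  · exact h.symm
  · exact absurd (h.trans_left (hl'.reflTransGen hl.1)) (not_transGen_inLinks l)

theorem IsLeader.eq_source {R : Set (Link E k n)} {l : Link E k n} {i : Fin k}
    (hl : G.IsLeader R l) (hi : .source i ∈ R) : l = .source i := by
  by_contra h
  obtain ⟨e, he, -⟩ := hl.2 _ hi (Ne.symm h)
  simp [inLinks_source] at he

theorem wellFounded_parents [Finite E] {D : Set (Set (Link E k n))}
    (hD : G.IsRegionDecomposition D) : WellFounded fun A B => A ∈ G.parents D B := by
  classical
  -- The parent relation is defined on all sets of links; those without a leader get the dummy rank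
  -- `none`, unrelated to everything.
  let r : Option (Link E k n) → Option (Link E k n) → Prop := fun x y =>
    ∃ a b, x = some a ∧ y = some b ∧ Relation.TransGen (fun a b => a ∈ G.inLinks b) a b
  have hr : WellFounded r := by
    have hsome : ∀ a : Link E k n, Acc r (some a) := fun a => by
      induction a using (G.wellFounded_inLinks).induction with
      | _ a ih =>
        refine ⟨_, ?_⟩
        rintro _ ⟨b, a', rfl, h, hba⟩
        exact ih b (Option.some.inj h ▸ hba)
    refine ⟨fun x => ?_⟩
    cases x with
    | none => exact ⟨_, by rintro _ ⟨a, b, rfl, h, -⟩; cases h⟩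
    | some a => exact hsome a
  let f : Set (Link E k n) → Option (Link E k n) := fun R =>
    if h : ∃ l, G.IsLeader R l then some h.choose else none
  have hf : ∀ R l, G.IsLeader R l → f R = some l := fun R l hl => by
    have h : ∃ l, G.IsLeader R l := ⟨l, hl⟩
    simp only [f]
    rw [dif_pos h, h.choose_spec.unique hl]
  refine Subrelation.wf ?_ (InvImage.wf f hr)
  rintro A B ⟨hA, l, hl, e, heA, hel⟩
  obtain ⟨m, hm⟩ := hD.2 A hA
  exact ⟨m, l, hf A m hm, hf B l hl, .tail' (hm.reflTransGen heA) hel⟩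

theorem IsRegionDecomposition.eq_of_mem {D : Set (Set (Link E k n))}
    (hD : G.IsRegionDecomposition D) {A B : Set (Link E k n)} (hA : A ∈ D) (hB : B ∈ D)
    {e : Link E k n} (heA : e ∈ A) (heB : e ∈ B) : A = B :=
  (hD.1.2 e).unique ⟨hA, heA⟩ ⟨hB, heB⟩

/-! ### Solvability of the network and feasibility of the region graph -/

theorem solvable_of_feasible [Finite E] {D : Set (Set (Link E k n))}
    (hD : G.IsRegionDecomposition D) (h : G.Feasible D) : G.Solvable := by
  obtain ⟨F, hF, hfin, d, hd⟩ := h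
  have hex : ∀ e, ∃ R ∈ D, e ∈ R := fun e => (hD.1.2 e).exists
  choose r hrD hr using hex
  refine ⟨F, hF, hfin, fun e => d (r e), ⟨fun i => ?_, fun e he => ?_, fun j => ?_⟩⟩
  · obtain ⟨l, hl⟩ := hD.2 _ (hrD (.source i))
    have hli := hl.eq_source (hr _)
    subst hli
    exact hd.source _ (hrD _) i hl
  · obtain ⟨l, hl⟩ := hD.2 _ (hrD e)
    by_cases hel : e = l
    · subst hel
      have hns : ¬ G.IsSourceRegion (r e) := fun ⟨i, hi⟩ => he i (hl.unique hi)
      refine Submodule.span_le.2 ?_ (hd.nonsource _ (hrD e) hns)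
      rintro _ ⟨A, ⟨hA, l, hl', e', heA, hel⟩, rfl⟩
      rw [hl'.unique hl] at hel
      refine Submodule.subset_span ⟨e', hel, ?_⟩
      rw [hD.eq_of_mem hA (hrD e') heA (hr e')]
    · obtain ⟨e', h1, h2⟩ := hl.2 e (hr e) hel
      refine Submodule.subset_span ⟨e', h1, ?_⟩
      exact congrArg d (hD.eq_of_mem (hrD e') (hrD e) (hr e') h2)
  · exact hd.terminal _ (hrD _) ⟨j, hr _⟩

/-- Non-leading links draw only on their own region, so all its vectors are multiples of the
leader's. Each region gets its leader's vector, replaced by the all-one vector in terminal regions;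
this does not change the spanned lines. -/
theorem feasible_of_solvable [Finite E] {D : Set (Set (Link E k n))}
    (hD : G.IsBasicRegionDecomposition D)
    (hST : ∀ R ∈ D, G.IsSourceRegion R → ¬ IsTerminalRegion R) (h : G.Solvable) :
    G.Feasible D := by
  classical
  obtain ⟨F, hF, hfin, d, hd⟩ := h
  have hP := hD.isRegionDecomposition
  choose lead hlead using hP.2
  have hmem : ∀ R (hR : R ∈ D), ∀ e ∈ R, d e ∈ Submodule.span F {d (lead R hR)} := by
    intro R hR e
    induction e using (G.wellFounded_inLinks).induction with
    | _ e ih =>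
      intro he
      by_cases hel : e = lead R hR
      · rw [hel]
        exact Submodule.mem_span_singleton_self _
      · refine Submodule.span_le.2 ?_ (hd.nonsource e fun i hi => ?_)
        · rintro _ ⟨e', he', rfl⟩
          exact ih e' (.single he') (hD.inLinks_subset R hR _ (hlead R hR) e he hel he')
        · exact hel (hi.trans ((hlead R hR).eq_source (hi ▸ he)).symm)
  let d' : Set (Link E k n) → Fin k → F := fun R => 
    if h : R ∈ D ∧ ¬ IsTerminalRegion R then d (lead R h.1) else 1
  have hd'1 : ∀ R, IsTerminalRegion R → d' R = 1 := fun R hR => dif_neg fun h => h.2 hR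
  have hd'2 : ∀ R (hR : R ∈ D), ¬ IsTerminalRegion R → d' R = d (lead R hR) :=
    fun R hR hT => dif_pos ⟨hR, hT⟩
  have hone : ∀ R (hR : R ∈ D), IsTerminalRegion R →
      (1 : Fin k → F) ∈ Submodule.span F {d (lead R hR)} := by
    rintro R hR ⟨j, hj⟩
    rw [← hd.terminal j]
    exact hmem R hR _ hj
  have hle : ∀ R (hR : R ∈ D), d' R ∈ Submodule.span F {d (lead R hR)} := by
    intro R hR
    by_cases hT : IsTerminalRegion R
    · rw [hd'1 R hT]
      exact hone R hR hT
    · rw [hd'2 R hR hT]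
      exact Submodule.mem_span_singleton_self _
  have hge : ∀ R (hR : R ∈ D), d (lead R hR) ∈ Submodule.span F {d' R} := by
    intro R hR
    by_cases hT : IsTerminalRegion R
    · rw [hd'1 R hT]
      obtain ⟨c, hc⟩ := Submodule.mem_span_singleton.1 (hone R hR hT)
      -- `c = 0` would say `0 = 1` in `Fin k → F`, which leaves no index `i`.
      by_cases h0 : c = 0
      · rw [h0, zero_smul] at hc
        have : d (lead R hR) = 0 := by
          ext i
          have := congrFun hc i
          simp at this
        rw [this]
        exact Submodule.zero_mem _
      · exact Submodule.mem_span_singleton.2 ⟨c⁻¹, by rw [← hc, inv_smul_smul₀ h0]⟩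
    · rw [hd'2 R hR hT]
      exact Submodule.mem_span_singleton_self _
  refine ⟨F, hF, hfin, d', ⟨fun R hR i hi => ?_, fun R hR hns => ?_, fun R _ hT => hd'1 R hT⟩⟩
  · rw [hd'2 R hR (hST R hR ⟨i, hi⟩), (hlead R hR).unique hi]
    exact hd.source i
  · refine Submodule.span_le.2 ?_ (hle R hR)
    rintro _ rfl
    refine Submodule.span_le.2 ?_ (hd.nonsource (lead R hR) fun i hi => hns ⟨i, ?_⟩)
    swap
    · have := hlead R hR
      rwa [hi] at this
    rintro _ ⟨e, he, rfl⟩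
    obtain ⟨A, ⟨hA, heA⟩, -⟩ := hP.1.2 e
    refine Submodule.span_le.2 ?_ (hmem A hA e heA)
    rintro _ rfl
    refine Submodule.span_mono ?_ (hge A hA)
    rintro _ rfl
    exact ⟨A, ⟨hA, _, hlead R hR, e, heA, he⟩, rfl⟩

theorem solvable_iff_feasible [Finite E] {D : Set (Set (Link E k n))}
    (hD : G.IsBasicRegionDecomposition D)
    (hST : ∀ R ∈ D, G.IsSourceRegion R → ¬ IsTerminalRegion R) : G.Solvable ↔ G.Feasible D :=
  ⟨feasible_of_solvable hD hST, solvable_of_feasible hD.isRegionDecomposition⟩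

end Leaders

/-! ### Translation between three-source networks and region systems. -/

section ThreeSources

variable {V E : Type*} {n : ℕ} {G : SumNetwork V E 3 n}

/-- The region system of a basic region decomposition. -/
def regionSystem [Finite E] {D : Set (Set (Link E 3 n))} (hD : G.IsBasicRegionDecomposition D)
    {S : Fin 3 → Set (Link E 3 n)} (hS : ∀ i, S i ∈ D ∧ G.IsSourceRegionOf i (S i)) :
    RegionSystem (Set (Link E 3 n)) where
  par := G.parents D
  inner := {R | R ∈ D ∧ ¬ G.IsSourceRegion R}
  src := S
  wf := wellFounded_parents hD.isRegionDecomposition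
  src_injective i j h := by
    have := (hS i).2.unique (h ▸ (hS j).2)
    simpa using this
  src_notMem i h := h.2 ⟨i, (hS i).2⟩
  par_src i := by
    refine Set.eq_empty_of_forall_notMem ?_
    rintro A ⟨-, l, hl, e, -, he⟩
    rw [hl.unique (hS i).2, inLinks_source] at he
    exact he
  mem_of_par := by
    rintro A B ⟨hA, -⟩
    by_cases h : G.IsSourceRegion A
    · obtain ⟨i, hi⟩ := h
      exact .inr ⟨i, hD.isRegionDecomposition.eq_of_mem hA (hS i).1 hi.1 (hS i).2.1⟩
    · exact .inl ⟨hA, h⟩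
  nontrivial R hR := hD.two_parents R hR.1 hR.2

theorem image_compl_eq_pair {β : Type*} (S : Fin 3 → β) {i j k : Fin 3} (hij : i ≠ j) (hjk : j ≠ k) (hik : i ≠ k) : S '' {i}ᶜ = {S j, S k} := by
  rw [← Set.image_pair]
  congr 1
  ext l
  simp only [Set.mem_compl_iff, Set.mem_singleton_iff, Set.mem_insert_iff]
  omega

variable [Finite E] {D : Set (Set (Link E 3 n))} {hD : G.IsBasicRegionDecomposition D}
  {S : Fin 3 → Set (Link E 3 n)} {hS : ∀ i, S i ∈ D ∧ G.IsSourceRegionOf i (S i)}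

variable (hD hS) in
theorem reg_eq_closure (Θ : Set (Set (Link E 3 n))) :
    G.reg D Θ = (regionSystem hD hS).closure Θ := by
  ext R
  constructor
  · intro h
    induction h with
    | base h => exact .base h
    | step hR hns _ ih => exact RegionSystem.InClosure.step ⟨hR, hns⟩ ih
  · intro h
    induction h with
    | base h => exact .base h
    | step hR _ ih => exact InSuperRegion.step hR.1 hR.2 ih

variable (hD hS) in
theorem reg_eq_side {i j k : Fin 3} (hij : i ≠ j) (hjk : j ≠ k) (hik : i ≠ k) :
    G.reg D {S j, S k} = (regionSystem hD hS).side i := by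
  rw [reg_eq_closure hD hS, ← image_compl_eq_pair S hij hjk hik]
  rfl

variable (hD hS) in
theorem regInt_eq_int {i j k : Fin 3} (hij : i ≠ j) (hjk : j ≠ k) (hik : i ≠ k) :
    G.regInt D {S j, S k} = (regionSystem hD hS).int i := by
  rw [regInt, reg_eq_side hD hS hij hjk hik]
  ext R
  constructor
  · rintro ⟨h, h'⟩
    refine ⟨h, RegionSystem.forall_fin_three hij hjk hik ?_ (fun e => h' (.inl e))
      fun e => h' (.inr e)⟩
    rintro rfl
    exact RegionSystem.src_mem_side.1 h rfl
  · rintro ⟨h, h'⟩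
    refine ⟨h, ?_⟩
    rintro (e | e)
    exacts [h' j e, h' k e]

variable (hD hS) in
theorem bigPi_eq_boundary : G.bigPi D S = (regionSystem hD hS).boundary := by
  rw [bigPi, reg_eq_side hD hS (i := 2) (j := 0) (k := 1) (by decide) (by decide) (by decide),
    reg_eq_side hD hS (i := 1) (j := 0) (k := 2) (by decide) (by decide) (by decide),
    reg_eq_side hD hS (i := 0) (j := 1) (k := 2) (by decide) (by decide) (by decide)]
  ext R
  constructor
  · rintro ((h | h) | h)
    exacts [⟨_, h⟩, ⟨_, h⟩, ⟨_, h⟩]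
  · rintro ⟨i, h⟩
    have : i = 0 ∨ i = 1 ∨ i = 2 := by omega
    rcases this with rfl | rfl | rfl
    exacts [.inr h, .inl (.inr h), .inl (.inl h)]

variable {T : Fin 3 → Set (Link E 3 n)}

theorem terminalSeparable_iff (hT : ∀ j, T j ∈ (regionSystem hD hS).inner) :
    G.TerminalSeparable D S T ↔ (regionSystem hD hS).Separable T := by
  classical
  constructor
  · intro h R hR t u ht hu
    by_contra htu
    have hR' := RegionSystem.mem_inner_of_path (hT t) hR ht
    have hI : 1 < (Finset.univ.filter fun j => G.Connected D R (T j)).card :=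
      Finset.one_lt_card.2 ⟨t, Finset.mem_filter.2 ⟨Finset.mem_univ _, ht⟩, u,
        Finset.mem_filter.2 ⟨Finset.mem_univ _, hu⟩, htu⟩
    refine Set.eq_empty_iff_forall_notMem.1 (h _ hI) R ⟨⟨hR'.1, ?_⟩, fun j => by simp⟩
    rwa [bigPi_eq_boundary hD hS]
  · intro h I hI
    refine Set.eq_empty_of_forall_notMem fun R hR => ?_
    obtain ⟨t, ht, u, hu, htu⟩ := Finset.one_lt_card.1 hI
    refine htu (h R ?_ t u ((hR.2 t).2 ht) ((hR.2 u).2 hu))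
    rw [← bigPi_eq_boundary hD hS]
    exact hR.1.2

/-- By separability, a region outside the boundary that reaches `T t` reaches no other terminal, so
`Omega` at `{t}` consists of all ancestors of `T t`. -/
theorem Lambda_eq_frontier (hT : ∀ j, T j ∈ (regionSystem hD hS).inner)
    (hsep : (regionSystem hD hS).Separable T) (t : Fin 3) :
    G.Lambda D S T {t} = (regionSystem hD hS).frontier (T t) := by
  have hΩ : ∀ R, R ∈ G.Omega D S T {t} ↔ R ∈ (regionSystem hD hS).ancestors (T t) := by
    intro R
    rw [Omega, bigPi_eq_boundary hD hS]
    constructor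
    · rintro ⟨h1, h2⟩
      exact ⟨h1.2, (h2 t).2 (by simp)⟩
    · rintro ⟨h1, h2⟩
      refine ⟨⟨(RegionSystem.mem_inner_of_path (hT t) h1 h2).1, h1⟩, fun j => ?_⟩
      rw [Finset.mem_singleton]
      refine ⟨fun h => hsep R h1 j t h h2, ?_⟩
      rintro rfl
      exact h2
  ext Q
  simp only [Lambda, hΩ, bigPi_eq_boundary hD hS]
  rfl

theorem exists_perm {i j k : Fin 3} (hij : i ≠ j) (hjk : j ≠ k) (hik : i ≠ k) :
    ∃ σ : Equiv.Perm (Fin 3), σ 0 = i ∧ σ 1 = j ∧ σ 2 = k := by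
  have hinj : Function.Injective ![i, j, k] := by
    intro a b h
    fin_cases a <;> fin_cases b <;> simp_all
  exact ⟨Equiv.ofBijective _ (Finite.injective_iff_bijective.1 hinj), rfl, rfl, rfl⟩

theorem perm_ne (σ : Equiv.Perm (Fin 3)) : σ 0 ≠ σ 1 ∧ σ 1 ≠ σ 2 ∧ σ 0 ≠ σ 2 :=
  ⟨σ.injective.ne (by decide), σ.injective.ne (by decide), σ.injective.ne (by decide)⟩

theorem CIR_iff (hT : ∀ j, T j ∈ (regionSystem hD hS).inner)
    (hsep : (regionSystem hD hS).Separable T) :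
    G.CIR D S T ↔ (regionSystem hD hS).Exceptional fun t => (regionSystem hD hS).frontier (T t) := by
  simp only [CIR, Lambda_eq_frontier hT hsep]
  constructor
  · rintro ⟨σ, τ, p, hp, q, hq, h1, h2, h3⟩
    obtain ⟨hσ1, hσ2, hσ3⟩ := perm_ne σ
    obtain ⟨hτ1, hτ2, hτ3⟩ := perm_ne τ
    rw [regInt_eq_int hD hS hσ1 hσ2 hσ3] at hp
    rw [regInt_eq_int hD hS hσ3.symm hσ1 hσ2.symm] at hq
    rw [reg_eq_side hD hS hσ1.symm hσ3 hσ2, reg_eq_closure hD hS] at h3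
    exact ⟨_, _, _, hσ1, hσ2, hσ3, _, _, _, hτ1, hτ2, hτ3, p, hp, q, hq, h1, h2, h3⟩
  · rintro ⟨i, j, k, hij, hjk, hik, t, u, w, htu, huw, htw, p, hp, q, hq, h1, h2, h3⟩
    obtain ⟨σ, rfl, rfl, rfl⟩ := exists_perm hij hjk hik
    obtain ⟨τ, rfl, rfl, rfl⟩ := exists_perm htu huw htw
    rw [← regInt_eq_int hD hS hij hjk hik] at hp
    rw [← regInt_eq_int hD hS hik.symm hij hjk.symm] at hq
    rw [← reg_eq_side hD hS hij.symm hik hjk, ← reg_eq_closure hD hS] at h3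
    exact ⟨σ, τ, p, hp, q, hq, h1, h2, h3⟩

theorem feasible_iff_hasCode (hTD : Set.range T = {R | R ∈ D ∧ IsTerminalRegion R}) :
    G.Feasible D ↔ (regionSystem hD hS).HasCode T := by
  constructor
  · rintro ⟨F, hF, hfin, d, hd⟩
    refine ⟨F, hF, hfin, d, ⟨fun i => hd.source _ (hS i).1 i (hS i).2,
      fun R hR => hd.nonsource R hR.1 hR.2⟩, fun t => ?_⟩
    have : T t ∈ {R | R ∈ D ∧ IsTerminalRegion R} := hTD ▸ ⟨t, rfl⟩
    exact hd.terminal _ this.1 this.2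
  · rintro ⟨F, hF, hfin, d, hd, h1⟩
    refine ⟨F, hF, hfin, d, ⟨fun R hR i hi => ?_, fun R hR hns => hd.inner R ⟨hR, hns⟩,
      fun R hR hRT => ?_⟩⟩
    · rw [hD.isRegionDecomposition.eq_of_mem hR (hS i).1 hi.1 (hS i).2.1]
      exact hd.src i
    · have : R ∈ Set.range T := hTD ▸ ⟨hR, hRT⟩
      obtain ⟨t, rfl⟩ := this
      exact h1 t

end ThreeSources

end SumNetwork

theorem mainTheorem2 {V E : Type*} [Finite V] [Finite E] {n : ℕ} (G : SumNetwork V E 3 n)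
    (D : Set (Set (Link E 3 n))) (hD : G.IsBasicRegionDecomposition D)
    (S : Fin 3 → Set (Link E 3 n)) (hS : ∀ i, S i ∈ D ∧ G.IsSourceRegionOf i (S i))
    (T : Fin 3 → Set (Link E 3 n)) (hT : Function.Injective T)
    (hTrange : Set.range T = {R | R ∈ D ∧ SumNetwork.IsTerminalRegion R})
    (hTPi : ∀ j, T j ∉ G.bigPi D S) :
    (¬ G.Feasible D ↔ G.TerminalSeparable D S T ∧ G.CIR D S T) ∧
    (¬ G.Solvable ↔ G.TerminalSeparable D S T ∧ G.CIR D S T) := by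
  have hsrc : ∀ R ∈ D, G.IsSourceRegion R → R ∈ G.bigPi D S := by
    rintro R hR ⟨i, hi⟩
    rw [hD.isRegionDecomposition.eq_of_mem hR (hS i).1 hi.1 (hS i).2.1,
      SumNetwork.bigPi_eq_boundary hD hS]
    exact RegionSystem.src_mem_boundary (Y := SumNetwork.regionSystem hD hS) i
  have hTD : ∀ j, T j ∈ D := fun j => by
    have : T j ∈ {R | R ∈ D ∧ SumNetwork.IsTerminalRegion R} := hTrange ▸ ⟨j, rfl⟩
    exact this.1
  have hTi : ∀ j, T j ∈ (SumNetwork.regionSystem hD hS).inner := fun j =>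
    ⟨hTD j, fun h => hTPi j (hsrc _ (hTD j) h)⟩
  have hST : ∀ R ∈ D, G.IsSourceRegion R → ¬ SumNetwork.IsTerminalRegion R := by
    intro R hR hs ht
    have : R ∈ Set.range T := hTrange ▸ ⟨hR, ht⟩
    obtain ⟨j, rfl⟩ := this
    exact hTPi j (hsrc _ hR hs)
  rw [SumNetwork.solvable_iff_feasible hD hST, and_self_iff,
    SumNetwork.feasible_iff_hasCode (hD := hD) (hS := hS) hTrange,
    RegionSystem.not_hasCode_iff hTi fun j => SumNetwork.bigPi_eq_boundary hD hS ▸ hTPi j,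
    SumNetwork.terminalSeparable_iff hTi]
  exact and_congr_right fun hsep => (SumNetwork.CIR_iff hTi hsep).symm
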